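/- Let $R$ be an associative ring with identity; modules are left $R$-modules. A short exact sequence of modules is *pure exact* if it stays exact after applying $M\otimes_R-$ for every right $R$-module $M$; its two maps are then called *pure monic* and *pure epic*. A module is *pure projective* (resp. *pure injective*) if it is projective (resp. injective) with respect to all pure exact sequences. A cochain complex $X$ of modules is *pure exact at $n$* if each of $d_X^{n-1}$ and $d_X^n$ is a pure epic map followed by a pure monic map and the sequence $0\to\operatorname{Ker}d_X^n\to X^n\to\operatorname{Coker}d_X^{n-1}\to0$ is pure exact; $X$ is *pure exact* if it is so at every $n\in\mathbb Z$. In $\mathbb Z\cup\{\pm\infty\}$ put $$\mathrm{inf_p}X=\inf\{n\in\mathbb Z\mid X\text{ is not pure exact at }n\},\qquad \mathrm{sup_p}X=\sup\{n\in\mathbb Z\mid X\text{ is not pure exact at }n\},$$ with $\inf\varnothing=+\infty$ and $\sup\varnothing=-\infty$. Let $\mathbf K(R)$ be the homotopy category of complexes of modules and $\mathbf K^b(R)$ its full subcategory of bounded complexes. The *bounded pure derived category* $\mathbf D^b_{\mathrm{pur}}(R)$ is the Verdier quotient of $\mathbf K^b(R)$ by the subcategory of bounded pure exact complexes. Let $\mathbf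 K^{-,pb}(\mathcal{PP})$ be the full triangulated subcategory of $\mathbf K(R)$ of the bounded above complexes $X$ of pure projective modules with $\mathrm{inf_p}X>-\infty$, and $\mathbf K^{+,pb}(\mathcal{PI})$ that of the bounded below complexes $X$ of pure injective modules with $\mathrm{sup_p}X<+\infty$. **Theorem.** For every ring $R$ there are equivalences of triangulated categories $$\text{(1)}\quad \mathbf D^b_{\mathrm{pur}}(R)\simeq\mathbf K^{-,pb}(\mathcal{PP}),\qquad\qquad \text{(2)}\quad \mathbf D^b_{\mathrm{pur}}(R)\simeq\mathbf K^{+,pb}(\mathcal{PI}).$$ -/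

import Mathlib

open CategoryTheory Limits Pretriangulated
open scoped TensorProduct ZeroObject

universe u

namespace PureDerived

noncomputable section

variable (R : Type u) [Ring R]

/-- The relations `(m · r) ⊗ a = m ⊗ (r · a)` imposed on `M ⊗[ℤ] A`. Right `R`-modules
are modules over the opposite ring, so `MulOpposite.op r • m` is `m · r`. -/
def balancedRelations (M : ModuleCat.{u} Rᵐᵒᵖ) (A : ModuleCat.{u} R) : AddSubgroup (M ⊗[ℤ] A) :=
  AddSubgroup.closure {t | ∃ (m : M) (r : R) (a : A),
    t = (MulOpposite.op r • m) ⊗ₜ[ℤ] a - m ⊗ₜ[ℤ] (r • a)}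

/-- The tensor product `M ⊗_R A` of a right `R`-module `M` and a left `R`-module `A` over a not
necessarily commutative ring `R`: an abelian group. -/
abbrev BalancedTensor (M : ModuleCat.{u} Rᵐᵒᵖ) (A : ModuleCat.{u} R) : Type u :=
  (M ⊗[ℤ] A) ⧸ balancedRelations R M A

variable {R}

/-- The map `M ⊗[ℤ] A → M ⊗[ℤ] B` induced by an `R`-linear map `A → B`. -/
def intTensorMap (M : ModuleCat.{u} Rᵐᵒᵖ) {A B : ModuleCat.{u} R} (f : A ⟶ B) :
    M ⊗[ℤ] A →+ M ⊗[ℤ] B :=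
  (f.hom.toAddMonoidHom.toIntLinearMap.lTensor M).toAddMonoidHom

@[simp]
lemma intTensorMap_tmul (M : ModuleCat.{u} Rᵐᵒᵖ) {A B : ModuleCat.{u} R} (f : A ⟶ B)
    (m : M) (a : A) : intTensorMap M f (m ⊗ₜ a) = m ⊗ₜ (f.hom a) := rfl

lemma balancedRelations_le_comap (M : ModuleCat.{u} Rᵐᵒᵖ) {A B : ModuleCat.{u} R} (f : A ⟶ B) :
    balancedRelations R M A ≤ (balancedRelations R M B).comap (intTensorMap M f) := by
  rw [balancedRelations, AddSubgroup.closure_le]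
  rintro _ ⟨m, r, a, rfl⟩
  exact AddSubgroup.subset_closure ⟨m, r, f.hom a, by simp⟩

/-- The map `M ⊗_R A → M ⊗_R B` induced by an `R`-linear map `A → B`. -/
def BalancedTensor.map (M : ModuleCat.{u} Rᵐᵒᵖ) {A B : ModuleCat.{u} R} (f : A ⟶ B) :
    BalancedTensor R M A →+ BalancedTensor R M B :=
  QuotientAddGroup.map _ _ (intTensorMap M f) (balancedRelations_le_comap M f)

lemma BalancedTensor.addHom_ext {M : ModuleCat.{u} Rᵐᵒᵖ} {A : ModuleCat.{u} R} {G : Type u}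
    [AddCommGroup G] {f g : BalancedTensor R M A →+ G}
    (h : ∀ (m : M) (a : A), f (QuotientAddGroup.mk (m ⊗ₜ a)) = g (QuotientAddGroup.mk (m ⊗ₜ a))) :
    f = g := by
  ext x
  change f (QuotientAddGroup.mk x) = g (QuotientAddGroup.mk x)
  induction x using TensorProduct.induction_on with
  | zero => rw [QuotientAddGroup.mk_zero, map_zero, map_zero]
  | tmul m a => exact h m a
  | add x y hx hy => rw [QuotientAddGroup.mk_add, map_add, map_add, hx, hy]

/-- The functor `M ⊗_R -` from left `R`-modules to abelian groups. -/
def tensorFunctor (M : ModuleCat.{u} Rᵐᵒᵖ) : ModuleCat.{u} R ⥤ AddCommGrpCat.{u} where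
  obj A := AddCommGrpCat.of (BalancedTensor R M A)
  map f := AddCommGrpCat.ofHom (BalancedTensor.map M f)
  map_id A := by
    ext1
    exact BalancedTensor.addHom_ext fun m a ↦ rfl
  map_comp f g := by
    ext1
    exact BalancedTensor.addHom_ext fun m a ↦ rfl

instance (M : ModuleCat.{u} Rᵐᵒᵖ) : (tensorFunctor M).Additive where
  map_add {A B f g} := by
    ext1
    refine BalancedTensor.addHom_ext fun m a ↦ ?_
    change QuotientAddGroup.mk (m ⊗ₜ (f.hom a + g.hom a)) = QuotientAddGroup.mk (m ⊗ₜ f.hom a) +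
      QuotientAddGroup.mk (m ⊗ₜ g.hom a)
    rw [TensorProduct.tmul_add, QuotientAddGroup.mk_add]

lemma tensorFunctor_map_surjective (M : ModuleCat.{u} Rᵐᵒᵖ) {A B : ModuleCat.{u} R} (f : A ⟶ B)
    (hf : Function.Surjective f) : Function.Surjective ((tensorFunctor M).map f) := by
  intro y
  obtain ⟨y, rfl⟩ := QuotientAddGroup.mk_surjective y
  obtain ⟨x, rfl⟩ := LinearMap.lTensor_surjective M
    (g := f.hom.toAddMonoidHom.toIntLinearMap) hf y
  exact ⟨QuotientAddGroup.mk x, rfl⟩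

lemma tensorFunctor_map_exact (M : ModuleCat.{u} Rᵐᵒᵖ) (S : ShortComplex (ModuleCat.{u} R))
    (hS : S.Exact) (hg : Function.Surjective S.g) (y : (tensorFunctor M).obj S.X₂)
    (hy : (tensorFunctor M).map S.g y = 0) : ∃ x, (tensorFunctor M).map S.f x = y := by
  obtain ⟨y, rfl⟩ := QuotientAddGroup.mk_surjective y
  have h1 : intTensorMap M S.g y ∈ balancedRelations R M S.X₃ :=
    (QuotientAddGroup.eq_zero_iff _).1 hy
  have h2 : balancedRelations R M S.X₃ ≤ (balancedRelations R M S.X₂).map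
      (intTensorMap M S.g) := by
    rw [balancedRelations, AddSubgroup.closure_le]
    rintro _ ⟨m, r, c, rfl⟩
    obtain ⟨b, rfl⟩ := hg c
    exact ⟨_, AddSubgroup.subset_closure ⟨m, r, b, rfl⟩, by simp⟩
  obtain ⟨s, hs, hs'⟩ := h2 h1
  have hex : Function.Exact S.f.hom.toAddMonoidHom.toIntLinearMap
      S.g.hom.toAddMonoidHom.toIntLinearMap :=
    (ShortComplex.ShortExact.moduleCat_exact_iff_function_exact S).1 hS
  have h3 : intTensorMap M S.g (y - s) = 0 := by rw [map_sub, hs', sub_self]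
  obtain ⟨x, hx⟩ := (lTensor_exact M hex hg (y - s)).1 h3
  refine ⟨QuotientAddGroup.mk x, ?_⟩
  change QuotientAddGroup.mk (LinearMap.lTensor M _ x) = QuotientAddGroup.mk y
  rw [hx, QuotientAddGroup.eq]
  have : -(y - s) + y = s := by abel
  rw [this]
  exact hs

/-- A short exact sequence of left `R`-modules is pure exact if it stays exact after
tensoring with any right `R`-module. -/
structure IsPureExact (S : ShortComplex (ModuleCat.{u} R)) : Prop where
  shortExact : S.ShortExact
  tensor (M : ModuleCat.{u} Rᵐᵒᵖ) : (S.map (tensorFunctor M)).ShortExact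

/-- A map is pure monic if it is the first map of a pure exact sequence. -/
def IsPureMono {A B : ModuleCat.{u} R} (f : A ⟶ B) : Prop :=
  ∃ (C : ModuleCat.{u} R) (g : B ⟶ C) (w : f ≫ g = 0), IsPureExact (ShortComplex.mk f g w)

/-- A map is pure epic if it is the second map of a pure exact sequence. -/
def IsPureEpi {B C : ModuleCat.{u} R} (g : B ⟶ C) : Prop :=
  ∃ (A : ModuleCat.{u} R) (f : A ⟶ B) (w : f ≫ g = 0), IsPureExact (ShortComplex.mk f g w)

/-- The map `d` is a pure epimorphism followed by a pure monomorphism. -/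
def HasPureFactorization {A B : ModuleCat.{u} R} (d : A ⟶ B) : Prop :=
  ∃ (D : ModuleCat.{u} R) (p : A ⟶ D) (i : D ⟶ B), IsPureEpi p ∧ IsPureMono i ∧ p ≫ i = d

/-- The complex `X` is pure exact at `n`: the differentials `d^{n-1}` and `d^n` both factor as
a pure epimorphism followed by a pure monomorphism, and the sequence
`0 → Ker d^n → X^n → Coker d^{n-1} → 0` is pure exact. -/
def PureExactAt (X : CochainComplex (ModuleCat.{u} R) ℤ) (n : ℤ) : Prop :=
  HasPureFactorization (X.d (n - 1) n) ∧ HasPureFactorization (X.d n (n + 1)) ∧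
    ∃ w : kernel.ι (X.d n (n + 1)) ≫ cokernel.π (X.d (n - 1) n) = 0,
      IsPureExact (ShortComplex.mk _ _ w)

/-- `inf_p X`: the infimum, in the integers extended by `±∞`, of the set of the degrees at which
`X` is not pure exact. -/
def infPur (X : CochainComplex (ModuleCat.{u} R) ℤ) : WithBot (WithTop ℤ) :=
  sInf {a | ∃ n : ℤ, ¬ PureExactAt X n ∧ a = ((n : WithTop ℤ) : WithBot (WithTop ℤ))}

/-- `sup_p X`: the supremum, in the integers extended by `±∞`, of the set of the degrees at which
`X` is not pure exact. -/
def supPur (X : CochainComplex (ModuleCat.{u} R) ℤ) : WithBot (WithTop ℤ) :=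
  sSup {a | ∃ n : ℤ, ¬ PureExactAt X n ∧ a = ((n : WithTop ℤ) : WithBot (WithTop ℤ))}

lemma infPur_ne_bot_iff (X : CochainComplex (ModuleCat.{u} R) ℤ) :
    infPur X ≠ ⊥ ↔ ∃ n : ℤ, ∀ i < n, PureExactAt X i := by
  constructor
  · intro h
    by_contra! H
    apply h
    generalize hv : infPur X = v
    have key : ∀ n : ℤ, v < ((n : WithTop ℤ) : WithBot (WithTop ℤ)) := by
      intro n
      obtain ⟨i, hi, hi'⟩ := H n
      rw [← hv]
      refine lt_of_le_of_lt (sInf_le ⟨i, hi', rfl⟩) ?_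
      exact_mod_cast hi
    induction v with
    | bot => rfl
    | coe v =>
      induction v with
      | top => exact absurd (key 0) (by simp)
      | coe m => exact absurd (key m) (lt_irrefl _)
  · rintro ⟨n, hn⟩ h
    have : ((n : WithTop ℤ) : WithBot (WithTop ℤ)) ≤ infPur X := by
      refine le_sInf ?_
      rintro _ ⟨i, hi, rfl⟩
      have : n ≤ i := by
        by_contra! hlt
        exact hi (hn i hlt)
      exact_mod_cast this
    rw [h] at this
    simp at this

lemma supPur_ne_top_iff (X : CochainComplex (ModuleCat.{u} R) ℤ) :
    supPur X ≠ ⊤ ↔ ∃ n : ℤ, ∀ i > n, PureExactAt X i := by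
  constructor
  · intro h
    by_contra! H
    apply h
    generalize hv : supPur X = v
    have key : ∀ n : ℤ, ((n : WithTop ℤ) : WithBot (WithTop ℤ)) < v := by
      intro n
      obtain ⟨i, hi, hi'⟩ := H n
      rw [← hv]
      refine lt_of_lt_of_le ?_ (le_sSup ⟨i, hi', rfl⟩)
      exact_mod_cast hi
    induction v with
    | bot => exact absurd (key 0) (by simp)
    | coe v =>
      induction v with
      | top => rfl
      | coe m => exact absurd (key m) (lt_irrefl _)
  · rintro ⟨n, hn⟩ h
    have : supPur X ≤ ((n : WithTop ℤ) : WithBot (WithTop ℤ)) := by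
      refine sSup_le ?_
      rintro _ ⟨i, hi, rfl⟩
      have : i ≤ n := by
        by_contra! hlt
        exact hi (hn i hlt)
      exact_mod_cast this
    rw [h] at this
    have h2 : ((n : WithTop ℤ) : WithBot (WithTop ℤ)) < ⊤ := by
      exact WithBot.coe_lt_coe.2 (WithTop.coe_lt_top n)
    exact absurd this (not_le.2 h2)

/-- `M ⊗_R X` is exact in degree `n` for every right `R`-module `M`. -/
def TensorExactAt (X : CochainComplex (ModuleCat.{u} R) ℤ) (n : ℤ) : Prop :=
  ∀ M : ModuleCat.{u} Rᵐᵒᵖ, (((tensorFunctor M).mapHomologicalComplex _).obj X).ExactAt n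

lemma tensorExactAt_iff (X : CochainComplex (ModuleCat.{u} R) ℤ) (i j k : ℤ) (hi : i + 1 = j)
    (hk : j + 1 = k) : TensorExactAt X j ↔ ∀ (M : ModuleCat.{u} Rᵐᵒᵖ)
      (y : (tensorFunctor M).obj (X.X j)), (tensorFunctor M).map (X.d j k) y = 0 →
        ∃ x, (tensorFunctor M).map (X.d i j) x = y := by
  refine forall_congr' fun M ↦ ?_
  rw [HomologicalComplex.exactAt_iff' _ i j k (by simp; lia) (by simp; lia),
    ShortComplex.ab_exact_iff]
  rfl

lemma PureExactAt.tensorExactAt {X : CochainComplex (ModuleCat.{u} R) ℤ} {n : ℤ}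
    (h : PureExactAt X n) : TensorExactAt X n := by
  rw [tensorExactAt_iff X (n - 1) n (n + 1) (by lia) rfl]
  intro M y hy
  obtain ⟨⟨D', p', i', ⟨A', f', w₁, hp'⟩, ⟨C', g', w₂, hi'⟩, fac'⟩,
    ⟨D, p, i, ⟨A, f, w₃, hp⟩, ⟨C, g, w₄, hi⟩, fac⟩, w, hw⟩ := h
  have hTi : Function.Injective ((tensorFunctor M).map i) :=
    (AddCommGrpCat.mono_iff_injective _).1 (hi.tensor M).mono_f
  have h1 : (tensorFunctor M).map p y = 0 := by
    apply hTi
    rw [← ConcreteCategory.comp_apply, ← Functor.map_comp, fac, hy, map_zero]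
  obtain ⟨a, rfl⟩ : ∃ a : (tensorFunctor M).obj A, (tensorFunctor M).map f a = y :=
    (ShortComplex.ab_exact_iff _).1 (hp.tensor M).exact y h1
  have := hi'.shortExact.mono_f
  have h2 : f ≫ cokernel.π (X.d (n - 1) n) = 0 := by
    rw [← kernel.lift_ι (X.d n (n + 1)) f (by rw [← fac, reassoc_of% w₃, zero_comp]),
      Category.assoc, w, comp_zero]
  have h3 : f ≫ g' = 0 := by
    rw [← cokernel.π_desc (X.d (n - 1) n) g' (by rw [← fac', Category.assoc, w₂, comp_zero]),
      reassoc_of% h2, zero_comp]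
  obtain ⟨l, h4⟩ : ∃ l : A ⟶ D', l ≫ i' = f :=
    ⟨hi'.shortExact.exact.lift f h3, hi'.shortExact.exact.lift_f f h3⟩
  have hTp : Function.Surjective ((tensorFunctor M).map p') :=
    (AddCommGrpCat.epi_iff_surjective _).1 (hp'.tensor M).epi_g
  obtain ⟨x, hx⟩ := hTp ((tensorFunctor M).map l a)
  refine ⟨x, ?_⟩
  rw [← fac', Functor.map_comp, ConcreteCategory.comp_apply, hx, ← ConcreteCategory.comp_apply,
    ← Functor.map_comp, h4]

/-- The multiplication map `R ⊗_R A → A`. -/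
def BalancedTensor.mul (A : ModuleCat.{u} R) :
    BalancedTensor R (ModuleCat.of Rᵐᵒᵖ R) A →+ A :=
  QuotientAddGroup.lift _
    (TensorProduct.liftAddHom (R := ℤ) (M := R) (N := A)
      (AddMonoidHom.mk' (fun r ↦ AddMonoidHom.mk' (fun a : A ↦ r • a) (smul_add r))
        (fun r s ↦ by ext a; exact add_smul r s a)) (fun n r a ↦ by
          change (n • r) • a = r • (n • a)
          rw [smul_assoc, smul_comm])) (by
    rw [balancedRelations, AddSubgroup.closure_le]
    rintro _ ⟨m, r, a, rfl⟩
    change (TensorProduct.liftAddHom _ _) _ = 0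
    rw [map_sub, sub_eq_zero]
    exact mul_smul (m : R) r a)

lemma BalancedTensor.mul_map {A B : ModuleCat.{u} R} (f : A ⟶ B)
    (x : (tensorFunctor (ModuleCat.of Rᵐᵒᵖ R)).obj A) :
    BalancedTensor.mul B ((tensorFunctor _).map f x) = f (BalancedTensor.mul A x) := by
  have : (BalancedTensor.mul B).comp (BalancedTensor.map _ f) =
      f.hom.toAddMonoidHom.comp (BalancedTensor.mul A) :=
    BalancedTensor.addHom_ext fun m a ↦ (f.hom.map_smul (m : R) a).symm
  exact DFunLike.congr_fun this x

lemma TensorExactAt.exact {X : CochainComplex (ModuleCat.{u} R) ℤ} {j : ℤ}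
    (h : TensorExactAt X j) (i k : ℤ) (hi : i + 1 = j) (hk : j + 1 = k) (y : X.X j)
    (hy : X.d j k y = 0) : ∃ x, X.d i j x = y := by
  rw [tensorExactAt_iff X i j k hi hk] at h
  obtain ⟨x, hx⟩ := h (ModuleCat.of Rᵐᵒᵖ R) (QuotientAddGroup.mk ((1 : R) ⊗ₜ y)) (by
    change QuotientAddGroup.mk ((1 : R) ⊗ₜ (X.d j k y)) = 0
    rw [hy, TensorProduct.tmul_zero, QuotientAddGroup.mk_zero])
  refine ⟨BalancedTensor.mul _ x, ?_⟩
  rw [← BalancedTensor.mul_map, hx]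
  exact one_smul R y

lemma TensorExactAt.kernel_lift_surjective {X : CochainComplex (ModuleCat.{u} R) ℤ} {j : ℤ}
    (h : TensorExactAt X j) (i k : ℤ) (hi : i + 1 = j) (hk : j + 1 = k) :
    Function.Surjective (kernel.lift (X.d j k) (X.d i j) (X.d_comp_d _ _ _)) := by
  intro z
  obtain ⟨x, hx⟩ := h.exact i k hi hk (kernel.ι (X.d j k) z) (by
    rw [← ConcreteCategory.comp_apply, kernel.condition]; rfl)
  refine ⟨x, (ModuleCat.mono_iff_injective (kernel.ι (X.d j k))).1 inferInstance ?_⟩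
  rw [← ConcreteCategory.comp_apply, kernel.lift_ι, hx]

lemma isPureExact_of_injective {S : ShortComplex (ModuleCat.{u} R)} (hS : S.ShortExact)
    (h : ∀ M : ModuleCat.{u} Rᵐᵒᵖ, Function.Injective ((tensorFunctor M).map S.f)) :
    IsPureExact S where
  shortExact := hS
  tensor M :=
    { exact := (ShortComplex.ab_exact_iff _).2 fun y hy ↦
        tensorFunctor_map_exact M S hS.exact hS.moduleCat_surjective_g y hy
      mono_f := (AddCommGrpCat.mono_iff_injective _).2 (h M)
      epi_g := (AddCommGrpCat.epi_iff_surjective _).2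
        (tensorFunctor_map_surjective M _ hS.moduleCat_surjective_g) }

lemma tensor_kernel_injective {X : CochainComplex (ModuleCat.{u} R) ℤ} {i j k : ℤ}
    (hi : i + 1 = j) (hk : j + 1 = k) (h : TensorExactAt X i) (h' : TensorExactAt X j)
    (M : ModuleCat.{u} Rᵐᵒᵖ) :
    Function.Injective ((tensorFunctor M).map (kernel.ι (X.d j k))) := by
  rw [injective_iff_map_eq_zero]
  intro z hz
  obtain ⟨w, rfl⟩ := tensorFunctor_map_surjective M _ (h'.kernel_lift_surjective i k hi hk) z
  rw [← ConcreteCategory.comp_apply, ← Functor.map_comp, kernel.lift_ι] at hz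
  obtain ⟨v, rfl⟩ := (tensorExactAt_iff X (i - 1) i j (by lia) hi).1 h M w hz
  rw [← ConcreteCategory.comp_apply, ← Functor.map_comp]
  have : X.d (i - 1) i ≫ kernel.lift (X.d j k) (X.d i j) (X.d_comp_d _ _ _) = 0 := by
    rw [← cancel_mono (kernel.ι _), Category.assoc, kernel.lift_ι, X.d_comp_d, zero_comp]
  rw [this, Functor.map_zero]
  rfl

lemma isPureMono_kernel {X : CochainComplex (ModuleCat.{u} R) ℤ} {i j k : ℤ}
    (hi : i + 1 = j) (hk : j + 1 = k) (h : TensorExactAt X i) (h' : TensorExactAt X j) :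
    IsPureMono (kernel.ι (X.d j k)) :=
  ⟨_, cokernel.π _, cokernel.condition _, isPureExact_of_injective
    { exact := ShortComplex.exact_cokernel _ } (tensor_kernel_injective hi hk h h')⟩

lemma isPureEpi_lift {X : CochainComplex (ModuleCat.{u} R) ℤ} {i j k l : ℤ}
    (hi : i + 1 = j) (hk : j + 1 = k) (hl : k + 1 = l) (h : TensorExactAt X i)
    (h' : TensorExactAt X j) (h'' : TensorExactAt X k) :
    IsPureEpi (kernel.lift (X.d k l) (X.d j k) (X.d_comp_d _ _ _)) := by
  refine ⟨_, kernel.ι (X.d j k), ?_, isPureExact_of_injective ?_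
    (tensor_kernel_injective hi hk h h')⟩
  · rw [← cancel_mono (kernel.ι _), Category.assoc, kernel.lift_ι, kernel.condition, zero_comp]
  · have : Epi (kernel.lift (X.d k l) (X.d j k) (X.d_comp_d _ _ _)) :=
      (ModuleCat.epi_iff_surjective _).2 (h''.kernel_lift_surjective j l hk hl)
    refine { exact := ShortComplex.exact_of_f_is_kernel _ ?_ }
    refine KernelFork.IsLimit.ofι' _ _ fun {A} a ha ↦ ⟨kernel.lift _ a ?_, kernel.lift_ι _ _ _⟩
    dsimp at ha
    rw [← kernel.lift_ι (X.d k l) (X.d j k) (X.d_comp_d _ _ _), reassoc_of% ha, zero_comp]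

lemma pureExactAt_of_tensorExactAt {X : CochainComplex (ModuleCat.{u} R) ℤ} {n : ℤ}
    (h : ∀ i, n - 2 ≤ i → i ≤ n + 1 → TensorExactAt X i) : PureExactAt X n := by
  have h₁ := h (n - 2) le_rfl (by lia)
  have h₂ := h (n - 1) (by lia) (by lia)
  have h₃ := h n (by lia) (by lia)
  have h₄ := h (n + 1) (by lia) le_rfl
  refine ⟨⟨_, kernel.lift (X.d n (n + 1)) (X.d (n - 1) n) (X.d_comp_d _ _ _), kernel.ι _,
    isPureEpi_lift (by lia) (by lia) rfl h₁ h₂ h₃, isPureMono_kernel (by lia) rfl h₂ h₃,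
      kernel.lift_ι _ _ _⟩,
    ⟨_, kernel.lift (X.d (n + 1) (n + 1 + 1)) (X.d n (n + 1)) (X.d_comp_d _ _ _), kernel.ι _,
    isPureEpi_lift (by lia) rfl rfl h₂ h₃ h₄, isPureMono_kernel rfl rfl h₃ h₄,
      kernel.lift_ι _ _ _⟩, ?_⟩
  have hs : Epi (kernel.lift (X.d n (n + 1)) (X.d (n - 1) n) (X.d_comp_d _ _ _)) :=
    (ModuleCat.epi_iff_surjective _).2 (h₃.kernel_lift_surjective _ _ (by lia) rfl)
  have w : kernel.ι (X.d n (n + 1)) ≫ cokernel.π (X.d (n - 1) n) = 0 := by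
    rw [← cancel_epi (kernel.lift (X.d n (n + 1)) (X.d (n - 1) n) (X.d_comp_d _ _ _)),
      kernel.lift_ι_assoc, cokernel.condition, comp_zero]
  refine ⟨w, isPureExact_of_injective ?_ (tensor_kernel_injective (by lia) rfl h₂ h₃)⟩
  refine { exact := ShortComplex.exact_of_g_is_cokernel _ ?_ }
  refine CokernelCofork.IsColimit.ofπ' _ _ fun {A} a ha ↦
    ⟨cokernel.desc _ a ?_, cokernel.π_desc _ _ _⟩
  dsimp at ha
  rw [← kernel.lift_ι (X.d n (n + 1)) (X.d (n - 1) n) (X.d_comp_d _ _ _), Category.assoc, ha,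
    comp_zero]

lemma forall_pureExactAt_iff (X : CochainComplex (ModuleCat.{u} R) ℤ) :
    (∀ n, PureExactAt X n) ↔ ∀ n, TensorExactAt X n :=
  ⟨fun h n ↦ (h n).tensorExactAt, fun h _ ↦ pureExactAt_of_tensorExactAt fun i _ _ ↦ h i⟩

lemma infPur_ne_bot_iff_tensor (X : CochainComplex (ModuleCat.{u} R) ℤ) :
    infPur X ≠ ⊥ ↔ ∃ n : ℤ, ∀ i < n, TensorExactAt X i := by
  rw [infPur_ne_bot_iff]
  exact ⟨fun ⟨n, h⟩ ↦ ⟨n, fun i hi ↦ (h i hi).tensorExactAt⟩, fun ⟨n, h⟩ ↦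
    ⟨n - 1, fun i hi ↦ pureExactAt_of_tensorExactAt fun j _ _ ↦ h j (by lia)⟩⟩

lemma supPur_ne_top_iff_tensor (X : CochainComplex (ModuleCat.{u} R) ℤ) :
    supPur X ≠ ⊤ ↔ ∃ n : ℤ, ∀ i > n, TensorExactAt X i := by
  rw [supPur_ne_top_iff]
  exact ⟨fun ⟨n, h⟩ ↦ ⟨n, fun i hi ↦ (h i hi).tensorExactAt⟩, fun ⟨n, h⟩ ↦
    ⟨n + 2, fun i hi ↦ pureExactAt_of_tensorExactAt fun j _ _ ↦ h j (by lia)⟩⟩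

/-- A module is pure projective if it is projective with respect to pure exact sequences. -/
def IsPureProjective (P : ModuleCat.{u} R) : Prop :=
  ∀ S : ShortComplex (ModuleCat.{u} R), IsPureExact S → ∀ f : P ⟶ S.X₃, ∃ g : P ⟶ S.X₂, g ≫ S.g = f

/-- A module is pure injective if it is injective with respect to pure exact sequences. -/
def IsPureInjective (I : ModuleCat.{u} R) : Prop :=
  ∀ S : ShortComplex (ModuleCat.{u} R), IsPureExact S → ∀ f : S.X₁ ⟶ I, ∃ g : S.X₂ ⟶ I, S.f ≫ g = f

lemma IsPureProjective.of_iso {P Q : ModuleCat.{u} R} (hP : IsPureProjective P) (e : P ≅ Q) :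
    IsPureProjective Q := fun S hS f ↦ by
  obtain ⟨g, hg⟩ := hP S hS (e.hom ≫ f)
  exact ⟨e.inv ≫ g, by rw [Category.assoc, hg, e.inv_hom_id_assoc]⟩

lemma IsPureInjective.of_iso {P Q : ModuleCat.{u} R} (hP : IsPureInjective P) (e : P ≅ Q) :
    IsPureInjective Q := fun S hS f ↦ by
  obtain ⟨g, hg⟩ := hP S hS (f ≫ e.inv)
  exact ⟨g ≫ e.hom, by rw [reassoc_of% hg, e.inv_hom_id, Category.comp_id]⟩

lemma isPureProjective_of_isZero {P : ModuleCat.{u} R} (hP : IsZero P) : IsPureProjective P :=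
  fun _ _ _ ↦ ⟨0, hP.eq_of_src _ _⟩

lemma isPureInjective_of_isZero {P : ModuleCat.{u} R} (hP : IsZero P) : IsPureInjective P :=
  fun _ _ _ ↦ ⟨0, hP.eq_of_tgt _ _⟩

lemma IsPureProjective.biprod {P Q : ModuleCat.{u} R} (hP : IsPureProjective P)
    (hQ : IsPureProjective Q) : IsPureProjective (P ⊞ Q) := fun S hS f ↦ by
  obtain ⟨g, hg⟩ := hP S hS (biprod.inl ≫ f)
  obtain ⟨h, hh⟩ := hQ S hS (biprod.inr ≫ f)
  exact ⟨biprod.desc g h, by apply biprod.hom_ext' <;> simp [hg, hh]⟩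

lemma IsPureInjective.biprod {P Q : ModuleCat.{u} R} (hP : IsPureInjective P)
    (hQ : IsPureInjective Q) : IsPureInjective (P ⊞ Q) := fun S hS f ↦ by
  obtain ⟨g, hg⟩ := hP S hS (f ≫ biprod.fst)
  obtain ⟨h, hh⟩ := hQ S hS (f ≫ biprod.snd)
  exact ⟨biprod.lift g h, by apply biprod.hom_ext <;> simp [hg, hh]⟩

/-- A property of complexes which holds for a zero complex and is stable under shifts and
mapping cones defines a triangulated subcategory of the homotopy category. -/
lemma isTriangulated_of_mappingCone (P : ObjectProperty (CochainComplex (ModuleCat.{u} R) ℤ))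
    (h0 : ∀ K, IsZero K → P K) (hshift : ∀ (K) (n : ℤ), P K → P (K⟦n⟧))
    (hcone : ∀ {K L} (f : K ⟶ L), P K → P L → P (CochainComplex.mappingCone f))
    (Q : ObjectProperty (HomotopyCategory (ModuleCat.{u} R) (ComplexShape.up ℤ)))
    (hQ : ∀ X, Q X ↔ P X.as) : Q.IsTriangulated := by
  have : Q.ContainsZero :=
    ⟨(HomotopyCategory.quotient _ _).obj 0, Functor.map_isZero _ (isZero_zero _),
      (hQ _).2 (h0 _ (isZero_zero _))⟩
  have : Q.IsStableUnderShift ℤ :=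
    ⟨fun n ↦ ⟨fun X hX ↦ by
      obtain ⟨K : CochainComplex _ _, rfl⟩ := X.quotient_obj_surjective
      rw [ObjectProperty.prop_shift_iff, HomotopyCategory.shift_quotient_obj]
      exact (hQ _).2 (hshift K n ((hQ _).1 hX))⟩⟩
  have : Q.IsTriangulatedClosed₃ := ⟨fun T hT h₁ h₂ ↦ by
    obtain ⟨f : T.obj₁.as ⟶ T.obj₂.as, hf⟩ :=
      (HomotopyCategory.quotient _ _).map_surjective T.mor₁
    refine ⟨_, (hQ _).2 (hcone f ((hQ _).1 h₁) ((hQ _).1 h₂)),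
      ⟨Triangle.π₃.mapIso (isoTriangleOfIso₁₂ T _ hT
        (HomotopyCategory.mappingCone_triangleh_distinguished f)
        (Iso.refl _) (Iso.refl _) ?_)⟩⟩
    exact (Category.comp_id _).trans (hf.symm.trans (Category.id_comp _).symm)⟩
  exact { toIsTriangulatedClosed₂ := .of_isTriangulatedClosed₃ }

variable (R)

/-- The homotopy category `K(R)` of complexes of left `R`-modules. -/
abbrev K := HomotopyCategory (ModuleCat.{u} R) (ComplexShape.up ℤ)

/-- The bounded complexes in `K(R)`. -/
def bounded : ObjectProperty (K R) := fun X ↦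
  ∃ m n : ℤ, CochainComplex.IsStrictlyGE X.as m ∧ CochainComplex.IsStrictlyLE X.as n

/-- The bounded above complexes of pure projective modules in `K(R)`. -/
def minusPP : ObjectProperty (K R) := fun X ↦
  (∃ n : ℤ, CochainComplex.IsStrictlyLE X.as n) ∧ ∀ i, IsPureProjective (X.as.X i)

/-- The bounded below complexes of pure injective modules in `K(R)`. -/
def plusPI : ObjectProperty (K R) := fun X ↦
  (∃ n : ℤ, CochainComplex.IsStrictlyGE X.as n) ∧ ∀ i, IsPureInjective (X.as.X i)

/-- The pure exact complexes in `K(R)`. -/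
def pureExact : ObjectProperty (K R) := fun X ↦ ∀ n, PureExactAt X.as n

/-- The complexes `X` in `K(R)` with `inf_p X > -∞`. -/
def infPurFinite : ObjectProperty (K R) := fun X ↦ infPur X.as ≠ ⊥

/-- The complexes `X` in `K(R)` with `sup_p X < ∞`. -/
def supPurFinite : ObjectProperty (K R) := fun X ↦ supPur X.as ≠ ⊤

variable {R}

lemma isStrictlyLE_mappingCone {X Y : CochainComplex (ModuleCat.{u} R) ℤ} (f : X ⟶ Y)
    {a b : ℤ} (ha : X.IsStrictlyLE a) (hb : Y.IsStrictlyLE b) :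
    (CochainComplex.mappingCone f).IsStrictlyLE (max a b) := by
  rw [CochainComplex.isStrictlyLE_iff]
  intro i hi
  rw [CochainComplex.mappingCone.isZero_X_iff]
  exact ⟨X.isZero_of_isStrictlyLE a _ (by lia), Y.isZero_of_isStrictlyLE b _ (by lia)⟩

lemma isStrictlyGE_mappingCone {X Y : CochainComplex (ModuleCat.{u} R) ℤ} (f : X ⟶ Y)
    {a b : ℤ} (ha : X.IsStrictlyGE a) (hb : Y.IsStrictlyGE b) :
    (CochainComplex.mappingCone f).IsStrictlyGE (min (a - 1) b) := by
  rw [CochainComplex.isStrictlyGE_iff]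
  intro i hi
  rw [CochainComplex.mappingCone.isZero_X_iff]
  exact ⟨X.isZero_of_isStrictlyGE a _ (by lia), Y.isZero_of_isStrictlyGE b _ (by lia)⟩

/-- The terms of a mapping cone. -/
def mappingConeXIso {X Y : CochainComplex (ModuleCat.{u} R) ℤ} (f : X ⟶ Y) (i : ℤ) :
    (CochainComplex.mappingCone f).X i ≅ X.X (i + 1) ⊞ Y.X i :=
  HomologicalComplex.homotopyCofiber.XIsoBiprod f i (i + 1) rfl

lemma isStrictly_of_isZero {X : CochainComplex (ModuleCat.{u} R) ℤ} (hX : IsZero X) (n : ℤ) :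
    X.IsStrictlyLE n ∧ X.IsStrictlyGE n := by
  rw [CochainComplex.isStrictlyGE_iff, CochainComplex.isStrictlyLE_iff]
  exact ⟨fun i _ ↦ (HomologicalComplex.eval _ _ i).map_isZero hX,
    fun i _ ↦ (HomologicalComplex.eval _ _ i).map_isZero hX⟩

instance : (bounded R).IsTriangulated :=
  isTriangulated_of_mappingCone (fun X ↦ ∃ m n : ℤ, X.IsStrictlyGE m ∧ X.IsStrictlyLE n)
    (fun _ hX ↦ ⟨0, 0, (isStrictly_of_isZero hX 0).2, (isStrictly_of_isZero hX 0).1⟩)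
    (fun X a ⟨m, n, _, _⟩ ↦ ⟨m - a, n - a, X.isStrictlyGE_shift m a _ (by lia),
      X.isStrictlyLE_shift n a _ (by lia)⟩)
    (fun f ⟨_, _, h₁, h₂⟩ ⟨_, _, h₃, h₄⟩ ↦
      ⟨_, _, isStrictlyGE_mappingCone f h₁ h₃, isStrictlyLE_mappingCone f h₂ h₄⟩)
    _ (fun _ ↦ Iff.rfl)

instance : (minusPP R).IsTriangulated :=
  isTriangulated_of_mappingCone
    (fun X ↦ (∃ n : ℤ, X.IsStrictlyLE n) ∧ ∀ i, IsPureProjective (X.X i))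
    (fun _ hX ↦ ⟨⟨0, (isStrictly_of_isZero hX 0).1⟩, fun i ↦
      isPureProjective_of_isZero ((HomologicalComplex.eval _ _ i).map_isZero hX)⟩)
    (fun X a ⟨⟨n, _⟩, h⟩ ↦ ⟨⟨n - a, X.isStrictlyLE_shift n a _ (by lia)⟩, fun i ↦
      (h (i + a)).of_iso (X.shiftFunctorObjXIso a i _ rfl).symm⟩)
    (fun f ⟨⟨_, h₁⟩, h₂⟩ ⟨⟨_, h₃⟩, h₄⟩ ↦ ⟨⟨_, isStrictlyLE_mappingCone f h₁ h₃⟩, fun i ↦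
      ((h₂ (i + 1)).biprod (h₄ i)).of_iso (mappingConeXIso f i).symm⟩)
    _ (fun _ ↦ Iff.rfl)

instance : (plusPI R).IsTriangulated :=
  isTriangulated_of_mappingCone
    (fun X ↦ (∃ n : ℤ, X.IsStrictlyGE n) ∧ ∀ i, IsPureInjective (X.X i))
    (fun _ hX ↦ ⟨⟨0, (isStrictly_of_isZero hX 0).2⟩, fun i ↦
      isPureInjective_of_isZero ((HomologicalComplex.eval _ _ i).map_isZero hX)⟩)
    (fun X a ⟨⟨n, _⟩, h⟩ ↦ ⟨⟨n - a, X.isStrictlyGE_shift n a _ (by lia)⟩, fun i ↦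
      (h (i + a)).of_iso (X.shiftFunctorObjXIso a i _ rfl).symm⟩)
    (fun f ⟨⟨_, h₁⟩, h₂⟩ ⟨⟨_, h₃⟩, h₄⟩ ↦ ⟨⟨_, isStrictlyGE_mappingCone f h₁ h₃⟩, fun i ↦
      ((h₂ (i + 1)).biprod (h₄ i)).of_iso (mappingConeXIso f i).symm⟩)
    _ (fun _ ↦ Iff.rfl)

/-- The functor `X ↦ H^n(M ⊗_R X)` on `K(R)`. -/
def tensorHomology (M : ModuleCat.{u} Rᵐᵒᵖ) (n : ℤ) : K R ⥤ AddCommGrpCat.{u} :=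
  (tensorFunctor M).mapHomotopyCategory (ComplexShape.up ℤ) ⋙
    HomotopyCategory.homologyFunctor AddCommGrpCat.{u} (ComplexShape.up ℤ) n

instance (M : ModuleCat.{u} Rᵐᵒᵖ) (n : ℤ) : (tensorHomology (R := R) M n).IsHomological := by
  unfold tensorHomology
  infer_instance

lemma tensorExactAt_iff_isZero (X : K R) (n : ℤ) :
    TensorExactAt X.as n ↔ ∀ M : ModuleCat.{u} Rᵐᵒᵖ, IsZero ((tensorHomology M n).obj X) := by
  refine forall_congr' fun M ↦ ?_
  rw [HomologicalComplex.exactAt_iff_isZero_homology]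
  exact (((HomotopyCategory.homologyFunctorFactors AddCommGrpCat.{u} (ComplexShape.up ℤ) n).app
    (((tensorFunctor M).mapHomologicalComplex _).obj X.as)).isZero_iff).symm

lemma tensorExactAt_of_iso {X Y : K R} (e : X ≅ Y) {n : ℤ} (h : TensorExactAt X.as n) :
    TensorExactAt Y.as n := by
  rw [tensorExactAt_iff_isZero] at h ⊢
  exact fun M ↦ (h M).of_iso ((tensorHomology M n).mapIso e.symm)

lemma tensorExactAt_of_triangle (T : Triangle (K R)) (hT : T ∈ distTriang (K R)) {n : ℤ}
    (h₁ : TensorExactAt T.obj₁.as n) (h₃ : TensorExactAt T.obj₃.as n) :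
    TensorExactAt T.obj₂.as n := by
  rw [tensorExactAt_iff_isZero] at h₁ h₃ ⊢
  exact fun M ↦ ((tensorHomology M n).map_distinguished_exact T hT).isZero_X₂
    ((h₁ M).eq_of_src _ _) ((h₃ M).eq_of_tgt _ _)

lemma tensorExactAt_shift_iff (X : K R) (a n : ℤ) :
    TensorExactAt (X⟦a⟧).as n ↔ TensorExactAt X.as (a + n) := by
  rw [tensorExactAt_iff_isZero, tensorExactAt_iff_isZero]
  refine forall_congr' fun M ↦ ?_
  exact (((HomotopyCategory.homologyFunctor AddCommGrpCat.{u} (ComplexShape.up ℤ) n).mapIso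
    ((((tensorFunctor M).mapHomotopyCategory (ComplexShape.up ℤ)).commShiftIso a).app X)) ≪≫
    ((HomotopyCategory.homologyFunctor AddCommGrpCat.{u} (ComplexShape.up ℤ) 0).shiftIso a n (a + n)
      rfl).app _).isZero_iff

lemma tensorExactAt_of_isZero {X : K R} (hX : IsZero X) (n : ℤ) : TensorExactAt X.as n := by
  rw [tensorExactAt_iff_isZero]
  exact fun M ↦ (tensorHomology M n).map_isZero hX

lemma pureExact_iff (X : K R) : pureExact R X ↔ ∀ n, TensorExactAt X.as n :=
  forall_pureExactAt_iff X.as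

lemma infPurFinite_iff (X : K R) : infPurFinite R X ↔ ∃ n : ℤ, ∀ i < n, TensorExactAt X.as i :=
  infPur_ne_bot_iff_tensor X.as

lemma supPurFinite_iff (X : K R) : supPurFinite R X ↔ ∃ n : ℤ, ∀ i > n, TensorExactAt X.as i :=
  supPur_ne_top_iff_tensor X.as

instance : (pureExact R).IsClosedUnderIsomorphisms where
  of_iso e h := by
    rw [pureExact_iff] at h ⊢
    exact fun n ↦ tensorExactAt_of_iso e (h n)

instance : (infPurFinite R).IsClosedUnderIsomorphisms where
  of_iso e h := by
    rw [infPurFinite_iff] at h ⊢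
    obtain ⟨n, h⟩ := h
    exact ⟨n, fun i hi ↦ tensorExactAt_of_iso e (h i hi)⟩

instance : (supPurFinite R).IsClosedUnderIsomorphisms where
  of_iso e h := by
    rw [supPurFinite_iff] at h ⊢
    obtain ⟨n, h⟩ := h
    exact ⟨n, fun i hi ↦ tensorExactAt_of_iso e (h i hi)⟩

instance : (pureExact R).IsTriangulated where
  exists_zero := ⟨_, isZero_zero _, (pureExact_iff _).2 (tensorExactAt_of_isZero (isZero_zero _))⟩
  isStableUnderShiftBy a := ⟨fun X hX ↦ by
    rw [pureExact_iff] at hX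
    rw [ObjectProperty.prop_shift_iff, pureExact_iff]
    exact fun n ↦ (tensorExactAt_shift_iff X a n).2 (hX _)⟩
  toIsTriangulatedClosed₂ := .mk' fun T hT h₁ h₃ ↦ by
    rw [pureExact_iff] at h₁ h₃ ⊢
    exact fun n ↦ tensorExactAt_of_triangle T hT (h₁ n) (h₃ n)

instance : (infPurFinite R).IsTriangulated where
  exists_zero := ⟨_, isZero_zero _, (infPurFinite_iff _).2
    ⟨0, fun i _ ↦ tensorExactAt_of_isZero (isZero_zero _) i⟩⟩
  isStableUnderShiftBy a := ⟨fun X hX ↦ by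
    obtain ⟨n, hn⟩ := (infPurFinite_iff _).1 hX
    rw [ObjectProperty.prop_shift_iff, infPurFinite_iff]
    exact ⟨n - a, fun i hi ↦ (tensorExactAt_shift_iff X a i).2 (hn _ (by lia))⟩⟩
  toIsTriangulatedClosed₂ := .mk' fun T hT h₁ h₃ ↦ by
    obtain ⟨m, hm⟩ := (infPurFinite_iff _).1 h₁
    obtain ⟨n, hn⟩ := (infPurFinite_iff _).1 h₃
    exact (infPurFinite_iff _).2 ⟨min m n, fun i hi ↦
      tensorExactAt_of_triangle T hT (hm i (by lia)) (hn i (by lia))⟩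

instance : (supPurFinite R).IsTriangulated where
  exists_zero := ⟨_, isZero_zero _, (supPurFinite_iff _).2
    ⟨0, fun i _ ↦ tensorExactAt_of_isZero (isZero_zero _) i⟩⟩
  isStableUnderShiftBy a := ⟨fun X hX ↦ by
    obtain ⟨n, hn⟩ := (supPurFinite_iff _).1 hX
    rw [ObjectProperty.prop_shift_iff, supPurFinite_iff]
    exact ⟨n - a, fun i hi ↦ (tensorExactAt_shift_iff X a i).2 (hn _ (by lia))⟩⟩
  toIsTriangulatedClosed₂ := .mk' fun T hT h₁ h₃ ↦ by
    obtain ⟨m, hm⟩ := (supPurFinite_iff _).1 h₁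
    obtain ⟨n, hn⟩ := (supPurFinite_iff _).1 h₃
    exact (supPurFinite_iff _).2 ⟨max m n, fun i hi ↦
      tensorExactAt_of_triangle T hT (hm i (by lia)) (hn i (by lia))⟩

variable (R)

/-- The bounded homotopy category `K^b(R)`, a triangulated subcategory of `K(R)`. -/
abbrev Kb := (bounded R).FullSubcategory

/-- The triangulated subcategory of `K^b(R)` of the pure exact complexes. -/
abbrev boundedPureExact : ObjectProperty (Kb R) := (pureExact R).inverseImage (bounded R).ι

/-- `K^{-,pb}(PP)`: the triangulated subcategory of `K(R)` of the bounded above complexes `X` of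
pure projective modules with `inf_p X > -∞`. -/
abbrev KMinusPbPP := (minusPP R ⊓ infPurFinite R).FullSubcategory

/-- `K^{+,pb}(PI)`: the triangulated subcategory of `K(R)` of the bounded below complexes `X` of
pure injective modules with `sup_p X < ∞`. -/
abbrev KPlusPbPI := (plusPI R ⊓ supPurFinite R).FullSubcategory

/-- The bounded pure derived category: the Verdier quotient of `K^b(R)` by the pure exact
complexes, i.e. the localization of `K^b(R)` at the morphisms with pure exact cone. -/
def DbPur := (boundedPureExact R).trW.Localization

instance : Category (DbPur R) := inferInstanceAs (Category (boundedPureExact R).trW.Localization)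

/-- The localization functor `K^b(R) → D^b_pur(R)`. -/
def DbPur.Q : Kb R ⥤ DbPur R := (boundedPureExact R).trW.Q

instance : (DbPur.Q R).IsLocalization (boundedPureExact R).trW :=
  inferInstanceAs ((boundedPureExact R).trW.Q.IsLocalization _)

instance : Preadditive (DbPur R) :=
  Localization.preadditive (DbPur.Q R) (boundedPureExact R).trW

instance : (DbPur.Q R).Additive :=
  Localization.functor_additive (DbPur.Q R) (boundedPureExact R).trW

instance : HasZeroObject (DbPur R) := (DbPur.Q R).hasZeroObject_of_additive

instance : HasShift (DbPur R) ℤ := HasShift.localized (DbPur.Q R) (boundedPureExact R).trW ℤ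

instance : (DbPur.Q R).CommShift ℤ :=
  Functor.CommShift.localized (DbPur.Q R) (boundedPureExact R).trW ℤ

instance (n : ℤ) : (shiftFunctor (DbPur R) n).Additive := by
  rw [Localization.functor_additive_iff (DbPur.Q R) (boundedPureExact R).trW]
  exact Functor.additive_of_iso ((DbPur.Q R).commShiftIso n)

instance : Pretriangulated (DbPur R) :=
  Triangulated.Localization.pretriangulated (DbPur.Q R) (boundedPureExact R).trW

instance : (DbPur.Q R).IsTriangulated :=
  Triangulated.Localization.isTriangulated_functor (DbPur.Q R) (boundedPureExact R).trW

instance : IsTriangulated (DbPur R) :=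
  Triangulated.Localization.isTriangulated (DbPur.Q R) (boundedPureExact R).trW

/-- Two triangulated categories are triangle equivalent: there is an equivalence of categories
which commutes with the shifts and preserves distinguished triangles. -/
def TriangleEquivalent (C D : Type*) [Category* C] [Category* D] [HasZeroObject C]
    [HasZeroObject D] [Preadditive C] [Preadditive D] [HasShift C ℤ] [HasShift D ℤ]
    [∀ n : ℤ, (shiftFunctor C n).Additive] [∀ n : ℤ, (shiftFunctor D n).Additive]
    [Pretriangulated C] [Pretriangulated D] : Prop :=
  ∃ (F : C ⥤ D) (_ : F.CommShift ℤ), F.IsEquivalence ∧ F.IsTriangulated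

end

end PureDerived

/-! Write `E` for the pure exact complexes in `K R`, `A` for the bounded complexes and `P` for the
full subcategory on the right of (1). Neither side of (1) is mapped directly to the other: both are
embedded in the Verdier quotient of `K R` by `E`, and shown to have the same essential image there.

Three facts do this. First, `P` is left orthogonal to `E`: a map from a bounded above complex of
pure projectives to a pure exact complex is null-homotopic (`minusPP_le_leftOrthogonal`). Hence
morphisms out of objects of `P` are the same in `K R` and in the quotient, and `P` embeds. Secondly,
every bounded complex receives a map from an object of `P` with pure exact cone
(`bounded_le_leftResolved`). Thirdly, a pair of maps from an object `Q` of `P` to bounded complexes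
factors through a truncation `Q ⟶ τ≥m Q` which has pure exact cone and bounded target
(`leftFactors_pureExact_bounded`). The last two facts turn morphisms of the quotient between bounded
complexes into fractions of bounded complexes, so that the quotient of `A` embeds too, and they
identify the essential images. The argument is formal (`triangleEquivalent_of_leftFactors`), and (2)
is its dual.

The module theory lies in the resolutions, which need enough pure projectives and pure injectives. A
module embeds purely in its double character module, and character modules are pure injective by the
adjunction of tensor product and Hom. On the other side, purity of `A ⟶ B` amounts to this: a finite
linear system with constants in `A` and a solution in `B` has a solution in `A`. So finitely
presented modules are pure projective, and the direct sum of those attached to all solved finite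
systems in `A` maps onto `A` with pure kernel.

Throughout, pure exactness is tested by exactness after all functors `M ⊗_R -`, which is homological
and compatible with shifts, cones and truncations. -/

namespace PureDerived

noncomputable section

/-! ### The tensor product over a noncommutative ring -/

section BalancedTensor

variable {R : Type u} [Ring R]

/-- The homomorphism out of `M ⊗_R A` induced by a balanced biadditive map. -/
def BalancedTensor.lift {M : ModuleCat.{u} Rᵐᵒᵖ} {A : ModuleCat.{u} R} {G : Type*}
    [AddCommGroup G] (h : M →+ A →+ G)
    (hh : ∀ (r : R) (m : M) (a : A), h (MulOpposite.op r • m) a = h m (r • a)) :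
    BalancedTensor R M A →+ G :=
  QuotientAddGroup.lift _ (TensorProduct.liftAddHom (R := ℤ) h (by simp)) (by
    rw [balancedRelations, AddSubgroup.closure_le]
    rintro _ ⟨m, r, a, rfl⟩
    change (TensorProduct.liftAddHom _ _) _ = 0
    rw [map_sub, TensorProduct.liftAddHom_tmul, TensorProduct.liftAddHom_tmul, hh, sub_self])

/-- The canonical biadditive map `M → A → M ⊗_R A`. -/
def BalancedTensor.mk (M : ModuleCat.{u} Rᵐᵒᵖ) (A : ModuleCat.{u} R) :
    M →+ A →+ BalancedTensor R M A :=
  AddMonoidHom.mk' (fun m ↦ AddMonoidHom.mk' (fun a ↦ QuotientAddGroup.mk (m ⊗ₜ[ℤ] a))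
    (fun a b ↦ by rw [TensorProduct.tmul_add, QuotientAddGroup.mk_add]))
    (fun m n ↦ by
      ext a
      change QuotientAddGroup.mk ((m + n) ⊗ₜ[ℤ] a) = _
      rw [TensorProduct.add_tmul, QuotientAddGroup.mk_add]
      rfl)

@[simp]
lemma BalancedTensor.lift_mk {M : ModuleCat.{u} Rᵐᵒᵖ} {A : ModuleCat.{u} R} {G : Type*}
    [AddCommGroup G] (h : M →+ A →+ G)
    (hh : ∀ (r : R) (m : M) (a : A), h (MulOpposite.op r • m) a = h m (r • a)) (m : M) (a : A) :
    BalancedTensor.lift h hh (BalancedTensor.mk M A m a) = h m a := rfl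

lemma BalancedTensor.mk_smul {M : ModuleCat.{u} Rᵐᵒᵖ} {A : ModuleCat.{u} R} (r : R) (m : M)
    (a : A) : BalancedTensor.mk M A (MulOpposite.op r • m) a = BalancedTensor.mk M A m (r • a) :=
  QuotientAddGroup.eq_iff_sub_mem.2 (AddSubgroup.subset_closure ⟨m, r, a, rfl⟩)

lemma tensorFunctor_map_mk (M : ModuleCat.{u} Rᵐᵒᵖ) {A B : ModuleCat.{u} R} (f : A ⟶ B)
    (m : M) (a : A) : (tensorFunctor M).map f (BalancedTensor.mk M A m a) =
      BalancedTensor.mk M B m (f a) := rfl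

lemma BalancedTensor.induction {M : ModuleCat.{u} Rᵐᵒᵖ} {A : ModuleCat.{u} R}
    {P : BalancedTensor R M A → Prop} (h0 : P 0) (hmk : ∀ m a, P (BalancedTensor.mk M A m a))
    (hadd : ∀ x y, P x → P y → P (x + y)) (x : BalancedTensor R M A) : P x := by
  obtain ⟨x, rfl⟩ := QuotientAddGroup.mk_surjective x
  induction x using TensorProduct.induction_on with
  | zero => exact h0
  | tmul m a => exact hmk m a
  | add x y hx hy => exact hadd _ _ hx hy

lemma BalancedTensor.hom_ext {M : ModuleCat.{u} Rᵐᵒᵖ} {A : ModuleCat.{u} R} {G : Type*}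
    [AddCommGroup G] {f g : BalancedTensor R M A →+ G}
    (h : ∀ m a, f (BalancedTensor.mk M A m a) = g (BalancedTensor.mk M A m a)) : f = g := by
  refine DFunLike.ext _ _ fun x ↦ BalancedTensor.induction (P := fun x ↦ f x = g x)
    ((map_zero f).trans (map_zero g).symm) h (fun x y hx hy ↦ ?_) x
  rw [map_add, map_add, hx, hy]

end BalancedTensor

/-! ### Character modules and enough pure injectives -/

section CharacterModule

variable {R : Type u} [Ring R]

/-- The left `R`-module of characters of a right `R`-module. -/
def RightDual (N : ModuleCat.{u} Rᵐᵒᵖ) : Type u := N →+ AddCircle (1 : ℚ)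

instance (N : ModuleCat.{u} Rᵐᵒᵖ) : AddCommGroup (RightDual N) :=
  inferInstanceAs (AddCommGroup (N →+ AddCircle (1 : ℚ)))

instance (N : ModuleCat.{u} Rᵐᵒᵖ) : Module R (RightDual N) where
  smul r φ := AddMonoidHom.comp (M := N) φ (DistribSMul.toAddMonoidHom N (MulOpposite.op r))
  one_smul φ := AddMonoidHom.ext fun n : N ↦ congrArg φ.toFun (one_smul Rᵐᵒᵖ n)
  mul_smul r s φ := AddMonoidHom.ext fun n : N ↦
    congrArg φ.toFun (mul_smul (MulOpposite.op s) (MulOpposite.op r) n)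
  smul_zero _ := rfl
  smul_add _ _ _ := rfl
  add_smul r s φ := AddMonoidHom.ext fun n : N ↦
    (congrArg φ.toFun (add_smul (MulOpposite.op r) (MulOpposite.op s) n)).trans
      (AddMonoidHom.map_add φ _ _)
  zero_smul φ := AddMonoidHom.ext fun n : N ↦
    (congrArg φ.toFun (zero_smul Rᵐᵒᵖ n)).trans (AddMonoidHom.map_zero φ)

/-- The right `R`-module of characters of a left `R`-module. -/
def LeftDual (A : ModuleCat.{u} R) : Type u := A →+ AddCircle (1 : ℚ)

instance (A : ModuleCat.{u} R) : AddCommGroup (LeftDual A) :=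
  inferInstanceAs (AddCommGroup (A →+ AddCircle (1 : ℚ)))

instance (A : ModuleCat.{u} R) : Module Rᵐᵒᵖ (LeftDual A) where
  smul r φ := AddMonoidHom.comp (M := A) φ (DistribSMul.toAddMonoidHom A r.unop)
  one_smul φ := AddMonoidHom.ext fun n : A ↦ congrArg φ.toFun (one_smul R n)
  mul_smul r s φ := AddMonoidHom.ext fun n : A ↦
    congrArg φ.toFun (mul_smul s.unop r.unop n)
  smul_zero _ := rfl
  smul_add _ _ _ := rfl
  add_smul r s φ := AddMonoidHom.ext fun n : A ↦
    (congrArg φ.toFun (add_smul r.unop s.unop n)).trans (AddMonoidHom.map_add φ _ _)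
  zero_smul φ := AddMonoidHom.ext fun n : A ↦
    (congrArg φ.toFun (zero_smul R n)).trans (AddMonoidHom.map_zero φ)

/-- Character modules of right modules are pure injective. -/
lemma isPureInjective_rightDual (N : ModuleCat.{u} Rᵐᵒᵖ) :
    IsPureInjective (ModuleCat.of R (RightDual N)) := fun S hS f ↦ by
  have hinj : Function.Injective ((tensorFunctor N).map S.f) :=
    (AddCommGrpCat.mono_iff_injective _).1 (hS.tensor N).mono_f
  -- By adjunction `f` is a character of `N ⊗ S.X₁`. It extends along the injection into `N ⊗ S.X₂`
  -- because `ℚ/ℤ` is divisible, and the extension is read back as a map to the dual.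
  let h : N →+ S.X₁ →+ AddCircle (1 : ℚ) :=
    AddMonoidHom.flip (f.hom.toAddMonoidHom : S.X₁ →+ (N →+ AddCircle (1 : ℚ)))
  have hh (r : R) (n : N) (a : S.X₁) : h (MulOpposite.op r • n) a = h n (r • a) :=
    (congrArg (fun φ : N →+ AddCircle (1 : ℚ) ↦ φ n) (f.hom.map_smul r a)).symm
  obtain ⟨χ, hχ⟩ := CharacterModule.dual_surjective_of_injective
    (((tensorFunctor N).map S.f).hom.toIntLinearMap) hinj (BalancedTensor.lift h hh)
  let χ' : BalancedTensor R N S.X₂ →+ AddCircle (1 : ℚ) := χ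
  let g : S.X₂ →ₗ[R] RightDual N :=
    { toFun b := χ'.comp ((BalancedTensor.mk N S.X₂).flip b)
      map_add' a b := AddMonoidHom.ext fun n : N ↦ by
        rw [map_add]
        exact χ'.map_add _ _
      map_smul' r b := AddMonoidHom.ext fun n : N ↦
        (congrArg χ' (BalancedTensor.mk_smul r n b)).symm }
  refine ⟨ModuleCat.ofHom g, ?_⟩
  ext a
  refine AddMonoidHom.ext fun n : N ↦ ?_
  exact DFunLike.congr_fun hχ (BalancedTensor.mk N S.X₁ n a)

/-- The evaluation map from a module to its double character module. -/
def toDoubleDual (A : ModuleCat.{u} R) :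
    A ⟶ ModuleCat.of R (RightDual (ModuleCat.of Rᵐᵒᵖ (LeftDual A))) :=
  ModuleCat.ofHom
    { toFun a := (AddMonoidHom.eval a : (A →+ AddCircle (1 : ℚ)) →+ AddCircle (1 : ℚ))
      map_add' a b := AddMonoidHom.ext fun φ : A →+ AddCircle (1 : ℚ) ↦ φ.map_add a b
      map_smul' _ _ := rfl }

/-- Characters separate points, so it is enough that every character `χ` of `N ⊗ A` extends to `N ⊗
A⁺⁺`. Such a `χ` is a map `e : N → A⁺`, and `n ⊗ ξ ↦ ξ (e n)` is the extension. -/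
lemma tensorFunctor_map_toDoubleDual_injective (N : ModuleCat.{u} Rᵐᵒᵖ) (A : ModuleCat.{u} R) :
    Function.Injective ((tensorFunctor N).map (toDoubleDual A)) := by
  rw [injective_iff_map_eq_zero]
  intro t ht
  refine CharacterModule.eq_zero_of_character_apply fun c ↦ ?_
  let χ : BalancedTensor R N A →+ AddCircle (1 : ℚ) := c
  let D := ModuleCat.of R (RightDual (ModuleCat.of Rᵐᵒᵖ (LeftDual A)))
  let e : N →+ (A →+ AddCircle (1 : ℚ)) := AddMonoidHom.mk'
    (fun n ↦ χ.comp (BalancedTensor.mk N A n)) (fun m n ↦ by ext a; simp)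
  let h : N →+ D →+ AddCircle (1 : ℚ) := AddMonoidHom.flip
    (AddMonoidHom.mk' (fun ξ : (A →+ AddCircle (1 : ℚ)) →+ AddCircle (1 : ℚ) ↦ ξ.comp e)
      (fun _ _ ↦ rfl) : D →+ N →+ AddCircle (1 : ℚ))
  have hh (r : R) (n : N) (ξ : D) : h (MulOpposite.op r • n) ξ = h n (r • ξ) := by
    have : e (MulOpposite.op r • n) = (show A →+ AddCircle (1 : ℚ) from
        (MulOpposite.op r • (show LeftDual A from e n) : LeftDual A)) :=
      AddMonoidHom.ext fun a ↦ congrArg χ (BalancedTensor.mk_smul r n a)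
    exact congrArg (show (A →+ AddCircle (1 : ℚ)) →+ AddCircle (1 : ℚ) from ξ) this
  have key : (BalancedTensor.lift h hh).comp ((tensorFunctor N).map (toDoubleDual A)).hom = χ :=
    BalancedTensor.hom_ext fun m a ↦ rfl
  change χ t = 0
  rw [← key]
  change BalancedTensor.lift h hh ((tensorFunctor N).map (toDoubleDual A) t) = 0
  rw [ht]
  exact map_zero (BalancedTensor.lift h hh)

/-- There are enough pure injective modules. -/
lemma exists_pureInjective (A : ModuleCat.{u} R) :
    ∃ (I : ModuleCat.{u} R) (f : A ⟶ I), IsPureInjective I ∧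
      ∀ N : ModuleCat.{u} Rᵐᵒᵖ, Function.Injective ((tensorFunctor N).map f) :=
  ⟨_, toDoubleDual A, isPureInjective_rightDual _,
    fun N ↦ tensorFunctor_map_toDoubleDual_injective N A⟩

end CharacterModule

/-! ### Purity in terms of finite systems of linear equations -/

section FiniteSystems

variable {R : Type u} [Ring R]

/-- A finite system of `R`-linear equations with constants in `A` which is solvable in `B` is
solvable in `A`. -/
def ReflectsSolvability {A B : ModuleCat.{u} R} (f : A ⟶ B) : Prop :=
  ∀ (m n : ℕ) (r : Fin m → Fin n → R) (a : Fin m → A) (b : Fin n → B),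
    (∀ i, ∑ j, r i j • b j = f (a i)) → ∃ a' : Fin n → A, ∀ i, ∑ j, r i j • a' j = a i

/-- Test injectivity on the right module `N` presented by the columns of the matrix. A solution in
`B` makes `∑ qᵢ ⊗ f aᵢ` vanish, where `qᵢ` are the generators of `N`, so `∑ qᵢ ⊗ aᵢ = 0`. The
natural map from `N ⊗ A` to `Aᵐ` modulo the image of the matrix then says that `a` lies in this
image. -/
lemma reflectsSolvability_of_tensor {A B : ModuleCat.{u} R} {f : A ⟶ B}
    (h : ∀ N : ModuleCat.{u} Rᵐᵒᵖ, Function.Injective ((tensorFunctor N).map f)) :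
    ReflectsSolvability f := by
  intro m n r a b hab
  let S : Submodule Rᵐᵒᵖ (Fin m → R) := Submodule.span Rᵐᵒᵖ (Set.range fun j i ↦ r i j)
  let N : ModuleCat.{u} Rᵐᵒᵖ := ModuleCat.of Rᵐᵒᵖ ((Fin m → R) ⧸ S)
  let φ : (Fin n → A) →+ (Fin m → A) := AddMonoidHom.mk' (fun a' i ↦ ∑ j, r i j • a' j)
    (fun x y ↦ by ext i; simp [Finset.sum_add_distrib])
  let W := (Fin m → A) ⧸ φ.range
  let h₀ : (Fin m → R) →+ A →+ W := AddMonoidHom.mk'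
    (fun e ↦ (QuotientAddGroup.mk' φ.range).comp
      (AddMonoidHom.mk' (fun x i ↦ e i • x) (fun x y ↦ by ext i; simp)))
    (fun e e' ↦ by
      ext x
      change QuotientAddGroup.mk' φ.range _ = QuotientAddGroup.mk' φ.range _ +
        QuotientAddGroup.mk' φ.range _
      rw [← map_add]
      congr 1
      ext i
      exact add_smul _ _ _)
  -- The `j`-th column times `x` is the value of the matrix at the vector with `x` in place `j`.
  have h₀S : ∀ e ∈ S, h₀ e = 0 := by
    intro e he
    induction he using Submodule.span_induction with
    | mem e he =>
      obtain ⟨j, rfl⟩ := he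
      ext x
      refine (QuotientAddGroup.eq_zero_iff _).2 ⟨Pi.single j x, ?_⟩
      ext i
      change ∑ k, r i k • (Pi.single j x : Fin n → A) k = r i j • x
      rw [Finset.sum_eq_single j (fun k _ hk ↦ by simp [hk]) (by simp)]
      simp
    | zero => exact map_zero _
    | add x y _ _ hx hy =>
      rw [map_add, hx, hy]
      exact add_zero (0 : A →+ W)
    | smul s e _ he =>
      ext x
      have := DFunLike.congr_fun he (s.unop • x)
      refine Eq.trans ?_ this
      change QuotientAddGroup.mk' φ.range _ = QuotientAddGroup.mk' φ.range _
      congr 1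
      ext i
      exact mul_smul (e i) s.unop x
  let H : N →+ A →+ W := QuotientAddGroup.lift S.toAddSubgroup h₀ h₀S
  have hH (s : R) (e : N) (x : A) : H (MulOpposite.op s • e) x = H e (s • x) := by
    obtain ⟨e, rfl⟩ := Submodule.Quotient.mk_surjective _ e
    change QuotientAddGroup.mk' φ.range _ = QuotientAddGroup.mk' φ.range _
    congr 1
    ext i
    exact mul_smul (e i) s x
  let q (i : Fin m) : N := Submodule.Quotient.mk (Pi.single i 1)
  have hq (j : Fin n) : ∑ i, MulOpposite.op (r i j) • q i = 0 := by
    have : ∑ i, MulOpposite.op (r i j) • q i =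
        Submodule.Quotient.mk (p := S) (fun i ↦ r i j) := by
      have h1 : (fun i ↦ r i j) = ∑ i, MulOpposite.op (r i j) • (Pi.single i 1 : Fin m → R) := by
        ext k
        simp [Finset.sum_apply, Pi.single_apply]
      rw [h1]
      exact (map_sum S.mkQ _ _).symm
    rw [this]
    exact (Submodule.Quotient.mk_eq_zero _).2 (Submodule.subset_span ⟨j, rfl⟩)
  have ht : ∑ i, BalancedTensor.mk N A (q i) (a i) = 0 := by
    apply h N
    refine Eq.trans ?_ (map_zero (BalancedTensor.map N f)).symm
    refine (map_sum (BalancedTensor.map N f) _ _).trans ?_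
    calc ∑ i, BalancedTensor.mk N B (q i) (f (a i))
        = ∑ i, ∑ j, BalancedTensor.mk N B (MulOpposite.op (r i j) • q i) (b j) := by
          refine Finset.sum_congr rfl fun i _ ↦ ?_
          rw [← hab, map_sum]
          exact Finset.sum_congr rfl fun j _ ↦ (BalancedTensor.mk_smul _ _ _).symm
      _ = ∑ j, BalancedTensor.mk N B (∑ i, MulOpposite.op (r i j) • q i) (b j) := by
          rw [Finset.sum_comm]
          refine Finset.sum_congr rfl fun j _ ↦ ?_
          rw [map_sum]
          exact (AddMonoidHom.finsetSum_apply _ _ _).symm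
      _ = 0 := Finset.sum_eq_zero fun j _ ↦ by rw [hq, map_zero]; rfl
  have h2 : QuotientAddGroup.mk' φ.range a = 0 := by
    have h3 := congrArg (BalancedTensor.lift H hH) ht
    rw [map_zero, map_sum] at h3
    rw [← h3]
    have : a = ∑ i, Pi.single i (a i) := (Finset.univ_sum_single a).symm
    conv_lhs => rw [this, map_sum]
    refine Finset.sum_congr rfl fun i _ ↦ ?_
    rw [BalancedTensor.lift_mk]
    change QuotientAddGroup.mk' φ.range _ = QuotientAddGroup.mk' φ.range _
    congr 1
    ext k
    by_cases hk : k = i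
    · subst hk; simp
    · simp [hk]
  obtain ⟨a', ha'⟩ := (QuotientAddGroup.eq_zero_iff _).1 h2
  exact ⟨a', fun i ↦ congrFun ha' i⟩

/-- The elements of `B^{(N)}` which are obtained from relations between the elements of `N`. -/
def relationSubgroup (N : ModuleCat.{u} Rᵐᵒᵖ) (B : ModuleCat.{u} R) : AddSubgroup (N →₀ B) where
  carrier := {w | ∃ (k : ℕ) (v : Fin k → (N →₀ R)) (p : Fin k → B),
    (∀ j, ((v j).sum fun n r ↦ MulOpposite.op r • n) = 0) ∧ ∀ n, w n = ∑ j, v j n • p j}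
  zero_mem' := ⟨0, Fin.elim0, Fin.elim0, fun j ↦ j.elim0, by simp⟩
  add_mem' := by
    rintro x y ⟨k, v, p, h₁, h₂⟩ ⟨l, v', p', h₁', h₂'⟩
    refine ⟨k + l, Fin.append v v', Fin.append p p', ?_, ?_⟩
    · intro j
      induction j using Fin.addCases with
      | left j => simpa using h₁ j
      | right j => simpa using h₁' j
    · intro n
      rw [Finsupp.add_apply, h₂, h₂', Fin.sum_univ_add]
      simp
  neg_mem' := by
    rintro x ⟨k, v, p, h₁, h₂⟩
    exact ⟨k, v, -p, h₁, by simp [h₂]⟩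

lemma relationSubgroup_mem_of (N : ModuleCat.{u} Rᵐᵒᵖ) (B : ModuleCat.{u} R) (v : N →₀ R) (p : B)
    (hv : (v.sum fun n r ↦ MulOpposite.op r • n) = 0) (w : N →₀ B) (hw : ∀ n, w n = v n • p) :
    w ∈ relationSubgroup N B :=
  ⟨1, fun _ ↦ v, fun _ ↦ p, fun _ ↦ hv, by simp [hw]⟩

/-- The equational criterion for vanishing of a tensor. The quotient of `B^{(N)}` by
`relationSubgroup N B` carries a balanced biadditive map from `N × B`, hence receives a map from `N
⊗ B` that sends the tensor of `w` to the class of `w`. -/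
lemma exists_relations {N : ModuleCat.{u} Rᵐᵒᵖ} {B : ModuleCat.{u} R} (w : N →₀ B)
    (hw : (w.sum fun n b ↦ BalancedTensor.mk N B n b) = 0) : w ∈ relationSubgroup N B := by
  classical
  have hsum (v : N →₀ R) (s : N) (r : R) :
      ((v + Finsupp.single s r).sum fun n r ↦ MulOpposite.op r • n) =
        (v.sum fun n r ↦ MulOpposite.op r • n) + MulOpposite.op r • s := by
    rw [Finsupp.sum_add_index' (by simp) (by intros; rw [MulOpposite.op_add, add_smul]),
      Finsupp.sum_single_index (by simp)]
  let π := QuotientAddGroup.mk' (relationSubgroup N B)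
  let h : N →+ B →+ (N →₀ B) ⧸ relationSubgroup N B := AddMonoidHom.mk'
    (fun n ↦ π.comp (Finsupp.singleAddHom n)) (fun n n' ↦ by
      ext b
      change π _ = π _ + π _
      rw [← map_add, ← sub_eq_zero, ← map_sub]
      -- Additivity in the first variable comes from the relation with coefficients `1, -1, -1` at
      -- `n + n'`, `n`, `n'`.
      refine (QuotientAddGroup.eq_zero_iff _).2 (relationSubgroup_mem_of N B
        (0 + Finsupp.single (n + n') 1 + Finsupp.single n (-1) + Finsupp.single n' (-1)) b ?_ _
          fun k ↦ ?_)
      · rw [hsum, hsum, hsum]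
        simp [add_assoc]
      · simp [Finsupp.single_apply, sub_eq_add_neg, add_smul, ite_smul]
        split_ifs <;> simp)
  have hh (r : R) (n : N) (b : B) : h (MulOpposite.op r • n) b = h n (r • b) := by
    change π _ = π _
    rw [← sub_eq_zero, ← map_sub]
    -- Balancedness comes from the relation with coefficients `1` at `n · r` and `-r` at `n`.
    refine (QuotientAddGroup.eq_zero_iff _).2 (relationSubgroup_mem_of N B
        (0 + Finsupp.single (MulOpposite.op r • n) 1 + Finsupp.single n (-r)) b ?_ _ fun k ↦ ?_)
    · rw [hsum, hsum]
      simp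
    · simp [Finsupp.single_apply, sub_eq_add_neg, add_smul, ite_smul]
  have h1 := congrArg (BalancedTensor.lift h hh) hw
  rw [map_zero, Finsupp.sum, map_sum] at h1
  refine (QuotientAddGroup.eq_zero_iff (N := relationSubgroup N B) w).1 ?_
  change π w = 0
  rw [← h1]
  conv_lhs => rw [← Finsupp.sum_single w, Finsupp.sum, map_sum]
  rfl

/-- If a tensor dies in `N ⊗ B`, its coefficients become combinations of elements `p j` of `B` along
relations in `N`. This is a finite system with constants in `A` solved by `p`; a solution in `A`
exhibits the same vanishing in `N ⊗ A`. -/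
lemma tensor_injective_of_reflectsSolvability {A B : ModuleCat.{u} R} {f : A ⟶ B}
    (hf : ReflectsSolvability f) (N : ModuleCat.{u} Rᵐᵒᵖ) :
    Function.Injective ((tensorFunctor N).map f) := by
  classical
  rw [injective_iff_map_eq_zero]
  intro t ht
  obtain ⟨w, rfl⟩ : ∃ w : N →₀ A, (w.sum fun n a ↦ BalancedTensor.mk N A n a) = t := by
    refine BalancedTensor.induction (P := fun t ↦ ∃ w : N →₀ A,
      (w.sum fun n a ↦ BalancedTensor.mk N A n a) = t) ⟨0, by simp⟩
        (fun n a ↦ ⟨Finsupp.single n a, by simp⟩) ?_ t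
    rintro _ _ ⟨x, rfl⟩ ⟨y, rfl⟩
    exact ⟨x + y, Finsupp.sum_add_index' (by simp) (by simp)⟩
  have hw : w.mapRange f (map_zero f.hom) ∈ relationSubgroup N B := by
    refine exists_relations _ (Eq.trans ?_ ht)
    rw [Finsupp.sum_mapRange_index (by simp)]
    exact (map_sum (BalancedTensor.map N f) (fun n ↦ BalancedTensor.mk N A n (w n)) w.support).symm
  obtain ⟨k, v, p, h₁, h₂⟩ := hw
  -- One equation for each element of `N` in the support of `w` or of some relation; all other
  -- equations are trivial.
  let T : Finset N := w.support ∪ Finset.univ.biUnion fun j ↦ (v j).support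
  obtain ⟨a', ha'⟩ := hf T.card k (fun i j ↦ v j (T.equivFin.symm i))
    (fun i ↦ w (T.equivFin.symm i)) p (fun i ↦ by simpa using (h₂ (T.equivFin.symm i)).symm)
  have ha (n) (hn : n ∈ T) : w n = ∑ j, v j n • a' j := by
    simpa using (ha' (T.equivFin ⟨n, hn⟩)).symm
  rw [Finsupp.sum_of_support_subset w (s := T) Finset.subset_union_left _ (by simp)]
  calc ∑ n ∈ T, BalancedTensor.mk N A n (w n)
      = ∑ n ∈ T, ∑ j, BalancedTensor.mk N A (MulOpposite.op (v j n) • n) (a' j) := by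
        refine Finset.sum_congr rfl fun n hn ↦ ?_
        rw [ha n hn, map_sum]
        exact Finset.sum_congr rfl fun j _ ↦ (BalancedTensor.mk_smul _ _ _).symm
    _ = ∑ j, BalancedTensor.mk N A (∑ n ∈ T, MulOpposite.op (v j n) • n) (a' j) := by
        rw [Finset.sum_comm]
        refine Finset.sum_congr rfl fun j _ ↦ ?_
        rw [map_sum]
        exact (AddMonoidHom.finsetSum_apply _ _ _).symm
    _ = 0 := Finset.sum_eq_zero fun j _ ↦ by
        have : ∑ n ∈ T, MulOpposite.op (v j n) • n = 0 := by
          rw [← h₁ j, Finsupp.sum_of_support_subset (v j) (s := T) (fun n hn ↦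
            Finset.mem_union_right _ (Finset.mem_biUnion.2 ⟨j, Finset.mem_univ _, hn⟩)) _ (by simp)]
        rw [this, map_zero]
        rfl

end FiniteSystems

/-! ### Finitely presented modules and enough pure projectives -/

section PureProjective

variable {R : Type u} [Ring R]

/-- The module presented by the rows of a finite matrix. -/
abbrev Presented {m n : ℕ} (r : Fin m → Fin n → R) : Type u :=
  (Fin n → R) ⧸ Submodule.span R (Set.range r)

/-- The `j`-th generator of a presented module. -/
def Presented.gen {m n : ℕ} (r : Fin m → Fin n → R) (j : Fin n) : Presented r :=
  Submodule.Quotient.mk (Pi.single j 1)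

lemma Presented.relation {m n : ℕ} (r : Fin m → Fin n → R) (i : Fin m) :
    ∑ j, r i j • Presented.gen r j = 0 := by
  have h1 : r i = ∑ j, r i j • (Pi.single j 1 : Fin n → R) := by
    ext k
    simp [Finset.sum_apply, Pi.single_apply]
  have : ∑ j, r i j • Presented.gen r j =
      Submodule.Quotient.mk (p := Submodule.span R (Set.range r)) (r i) := by
    conv_rhs => rw [h1]
    exact (map_sum (Submodule.span R (Set.range r)).mkQ _ _).symm
  rw [this]
  exact (Submodule.Quotient.mk_eq_zero _).2 (Submodule.subset_span ⟨i, rfl⟩)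

/-- A linear map out of a presented module, from a solution of the system of equations. -/
def Presented.lift {m n : ℕ} {r : Fin m → Fin n → R} {B : Type*} [AddCommGroup B] [Module R B]
    (b : Fin n → B) (hb : ∀ i, ∑ j, r i j • b j = 0) : Presented r →ₗ[R] B :=
  Submodule.liftQ _ (Fintype.linearCombination R b) (by
    rw [Submodule.span_le]
    rintro _ ⟨i, rfl⟩
    exact hb i)

@[simp]
lemma Presented.lift_gen {m n : ℕ} {r : Fin m → Fin n → R} {B : Type*} [AddCommGroup B]
    [Module R B] (b : Fin n → B) (hb : ∀ i, ∑ j, r i j • b j = 0) (j : Fin n) :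
    Presented.lift b hb (Presented.gen r j) = b j := by
  change Fintype.linearCombination R b (Pi.single j 1) = b j
  simp [Fintype.linearCombination_apply_single]

lemma Presented.hom_ext {m n : ℕ} {r : Fin m → Fin n → R} {B : Type*} [AddCommGroup B]
    [Module R B] {f g : Presented r →ₗ[R] B}
    (h : ∀ j, f (Presented.gen r j) = g (Presented.gen r j)) : f = g := by
  refine Submodule.linearMap_qext _ (LinearMap.pi_ext' fun j ↦ ?_)
  ext
  exact h j

/-- Lift the images of the generators arbitrarily to `b j`. The defect of the relations lies in the
image of `S.X₁`, so `b` solves a system with constants there; subtracting a solution from `S.X₁`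
makes the relations hold. -/
lemma Presented.isPureProjective {m n : ℕ} (r : Fin m → Fin n → R) :
    IsPureProjective (ModuleCat.of R (Presented r)) := fun S hS f ↦ by
  have hf : ReflectsSolvability S.f := reflectsSolvability_of_tensor fun N ↦
    (AddCommGrpCat.mono_iff_injective _).1 (hS.tensor N).mono_f
  have hex : Function.Exact S.f S.g :=
    (ShortComplex.ShortExact.moduleCat_exact_iff_function_exact S).1 hS.shortExact.exact
  choose b hb using fun j ↦ hS.shortExact.moduleCat_surjective_g (f (Presented.gen r j))
  have hb' (i : Fin m) : S.g (∑ j, r i j • b j) = 0 := by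
    rw [map_sum]
    simp only [map_smul, hb]
    have := congrArg f.hom (Presented.relation r i)
    rw [map_sum, map_zero] at this
    simp only [map_smul] at this
    exact this
  choose a ha using fun i ↦ (hex _).1 (hb' i)
  obtain ⟨a', ha'⟩ := hf m n r a b (fun i ↦ (ha i).symm)
  have this (i : Fin m) : ∑ j, r i j • (b j - S.f (a' j)) = 0 := by
    simp only [smul_sub, Finset.sum_sub_distrib, ← map_smul, ← map_sum, ha', ha, sub_self]
  refine ⟨ModuleCat.ofHom (Presented.lift (fun j ↦ b j - S.f (a' j)) this), ?_⟩
  · refine ModuleCat.hom_ext (Presented.hom_ext fun j ↦ ?_)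
    refine (congrArg S.g (Presented.lift_gen _ this j)).trans ?_
    rw [map_sub, hb, hex.apply_apply_eq_zero, sub_zero]

/-- The finite systems of equations together with a solution in `A`. -/
abbrev SolvedSystem (A : ModuleCat.{u} R) : Type u :=
  Σ (m n : ℕ) (r : Fin m → Fin n → R), {x : Fin n → A // ∀ i, ∑ j, r i j • x j = 0}

/-- A pure projective module with a pure epimorphism to `A`. -/
abbrev PureCover (A : ModuleCat.{u} R) : ModuleCat.{u} R :=
  ModuleCat.of R (DirectSum (SolvedSystem A) fun x ↦ Presented x.2.2.1)

/-- The pure epimorphism `PureCover A ⟶ A`. -/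
def PureCover.π (A : ModuleCat.{u} R) : PureCover A ⟶ A :=
  ModuleCat.ofHom (by
    classical
    exact DirectSum.toModule R _ A fun x ↦ Presented.lift x.2.2.2.1 x.2.2.2.2)

/-- The lift is given by the generators of the summand indexed by this very solved system. -/
lemma PureCover.exists_lift (A : ModuleCat.{u} R) {m n : ℕ} (r : Fin m → Fin n → R) (x : Fin n → A)
    (hx : ∀ i, ∑ j, r i j • x j = 0) : ∃ q : Fin n → PureCover A,
      (∀ i, ∑ j, r i j • q j = 0) ∧ ∀ j, PureCover.π A (q j) = x j := by
  classical
  let s : SolvedSystem A := ⟨m, n, r, x, hx⟩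
  refine ⟨fun j ↦ DirectSum.lof R (SolvedSystem A) (fun x ↦ Presented x.2.2.1) s
    (Presented.gen r j), fun i ↦ ?_, fun j ↦ ?_⟩
  · simp only [← map_smul, ← map_sum]
    exact (congrArg _ (Presented.relation r i)).trans (map_zero _)
  · refine (DirectSum.toModule_lof R s _).trans ?_
    exact Presented.lift_gen (r := r) x hx j

lemma PureCover.isPureProjective (A : ModuleCat.{u} R) : IsPureProjective (PureCover A) :=
  fun S hS f ↦ by
    classical
    choose g hg using fun x : SolvedSystem A ↦ Presented.isPureProjective x.2.2.1 S hS
      (ModuleCat.ofHom (f.hom.comp (DirectSum.lof R (SolvedSystem A)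
        (fun x ↦ Presented x.2.2.1) x)))
    refine ⟨ModuleCat.ofHom (DirectSum.toModule R _ S.X₂ fun x ↦ (g x).hom), ?_⟩
    refine ModuleCat.hom_ext (DirectSum.linearMap_ext R fun x ↦ ?_)
    rw [← ModuleCat.hom_ofHom (f.hom.comp _), ← hg x]
    ext y
    simp

lemma PureCover.surjective (A : ModuleCat.{u} R) : Function.Surjective (PureCover.π A) := by
  intro x
  -- An element is a solution of the system with one unknown and no equation.
  obtain ⟨q, -, hq⟩ := PureCover.exists_lift A (m := 0) (n := 1) Fin.elim0 (fun _ ↦ x) (by simp)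
  exact ⟨q 0, hq 0⟩

/-- A solution `p` in the cover, with constants in the kernel, maps to a solution of the homogeneous
system in `A`. Lift that to a homogeneous solution `q` in the cover; then `p - q` lies in the kernel
and solves the original system. -/
lemma PureCover.reflectsSolvability (A : ModuleCat.{u} R) :
    ReflectsSolvability (kernel.ι (PureCover.π A)) := by
  intro m n r a p hp
  have h0 (z : (kernel (PureCover.π A) : ModuleCat.{u} R)) :
      PureCover.π A (kernel.ι (PureCover.π A) z) = 0 := by
    rw [← ConcreteCategory.comp_apply, kernel.condition]
    rfl
  have hinj := (ModuleCat.mono_iff_injective (kernel.ι (PureCover.π A))).1 inferInstance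
  obtain ⟨q, hq, hq'⟩ := PureCover.exists_lift A r (fun j ↦ PureCover.π A (p j)) (fun i ↦ by
    simp only [← map_smul, ← map_sum]
    rw [hp, h0])
  have hex : Function.Exact (kernel.ι (PureCover.π A)) (PureCover.π A) :=
    (ShortComplex.ShortExact.moduleCat_exact_iff_function_exact
      (ShortComplex.mk _ _ (kernel.condition _))).1 (ShortComplex.exact_kernel _)
  choose a' ha' using fun j ↦ (hex (p j - q j)).1 (by rw [map_sub, hq', sub_self])
  refine ⟨a', fun i ↦ hinj ?_⟩
  rw [map_sum]
  simp only [map_smul, ha', smul_sub]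
  exact (Finset.sum_sub_distrib (fun j ↦ r i j • p j) (fun j ↦ r i j • q j)).trans
    ((congrArg₂ (· - ·) (hp i) (hq i)).trans (sub_zero _))

/-- There are enough pure projective modules. -/
lemma exists_pureProjective (A : ModuleCat.{u} R) :
    ∃ (P : ModuleCat.{u} R) (f : P ⟶ A), IsPureProjective P ∧ Epi f ∧
      ∀ N : ModuleCat.{u} Rᵐᵒᵖ, Function.Injective ((tensorFunctor N).map (kernel.ι f)) :=
  ⟨_, PureCover.π A, PureCover.isPureProjective A,
    (ModuleCat.epi_iff_surjective _).2 (PureCover.surjective A),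
    tensor_injective_of_reflectsSolvability (PureCover.reflectsSolvability A)⟩

end PureProjective

/-! ### Verdier quotients: resolutions and comparison functors -/

section Verdier

variable {C : Type*} [Category* C] [HasZeroObject C] [HasShift C ℤ] [Preadditive C]
  [∀ n : ℤ, (shiftFunctor C n).Additive] [Pretriangulated C] [IsTriangulated C]

section TwoOutOfThree

variable (E : ObjectProperty C) [E.IsTriangulated] [E.IsClosedUnderIsomorphisms]

/-- By the octahedral axiom the cones of `f`, `f ≫ g` and `g` form a distinguished triangle. -/
lemma trW_of_precomp {X Y Z : C} {f : X ⟶ Y} {g : Y ⟶ Z} (hf : E.trW f) (hfg : E.trW (f ≫ g)) :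
    E.trW g := by
  obtain ⟨Z₁, v₁, w₁, h₁⟩ := distinguished_cocone_triangle f
  obtain ⟨Z₂, v₂, w₂, h₂⟩ := distinguished_cocone_triangle g
  obtain ⟨Z₃, v₃, w₃, h₃⟩ := distinguished_cocone_triangle (f ≫ g)
  have H := Triangulated.someOctahedron rfl h₁ h₂ h₃
  have h := E.ext_of_isTriangulatedClosed₃ _ H.mem
    ((E.trW_iff_of_distinguished _ h₁).1 hf) ((E.trW_iff_of_distinguished _ h₃).1 hfg)
  exact .mk E h₂ h

lemma trW_of_postcomp {X Y Z : C} {f : X ⟶ Y} {g : Y ⟶ Z} (hg : E.trW g) (hfg : E.trW (f ≫ g)) :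
    E.trW f := by
  obtain ⟨Z₁, v₁, w₁, h₁⟩ := distinguished_cocone_triangle f
  obtain ⟨Z₂, v₂, w₂, h₂⟩ := distinguished_cocone_triangle g
  obtain ⟨Z₃, v₃, w₃, h₃⟩ := distinguished_cocone_triangle (f ≫ g)
  have H := Triangulated.someOctahedron rfl h₁ h₂ h₃
  have h := E.ext_of_isTriangulatedClosed₁ _ H.mem
    ((E.trW_iff_of_distinguished _ h₃).1 hfg) ((E.trW_iff_of_distinguished _ h₂).1 hg)
  exact .mk E h₁ h

end TwoOutOfThree

section Resolved

variable (E P : ObjectProperty C) [E.IsTriangulated] [P.IsTriangulated]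

/-- The objects which receive a morphism from an object in `P` with cone in `E`. -/
def leftResolved : ObjectProperty C := fun X ↦ ∃ (Q : C) (s : Q ⟶ X), P Q ∧ E.trW s

/-- The objects which have a morphism to an object in `P` with cone in `E`. -/
def rightResolved : ObjectProperty C := fun X ↦ ∃ (Q : C) (s : X ⟶ Q), P Q ∧ E.trW s

instance : (leftResolved E P).IsClosedUnderIsomorphisms where
  of_iso e := fun ⟨Q, s, hQ, hs⟩ ↦ ⟨Q, s ≫ e.hom, hQ, E.trW.comp_mem _ _ hs (E.trW_of_isIso _)⟩

instance : (rightResolved E P).IsClosedUnderIsomorphisms where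
  of_iso e := fun ⟨Q, s, hQ, hs⟩ ↦ ⟨Q, e.inv ≫ s, hQ, E.trW.comp_mem _ _ (E.trW_of_isIso _) hs⟩

variable {E P} in
-- Objects of `P` are colocal for maps with cone in `E`, so a morphism between resolved objects
-- lifts to their resolutions. The cone of the lift lies in `P` and resolves the cone.
lemma leftResolved_isTriangulated (h : P ≤ E.leftOrthogonal) :
    (leftResolved E P).IsTriangulated := by
  have : (leftResolved E P).ContainsZero := by
    obtain ⟨Z, hZ, hZ'⟩ := P.exists_prop_of_containsZero
    exact ⟨Z, hZ, Z, 𝟙 Z, hZ', E.trW_of_isIso _⟩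
  have : (leftResolved E P).IsStableUnderShift ℤ := ⟨fun n ↦ ⟨fun X ⟨Q, s, hQ, hs⟩ ↦
    ⟨Q⟦n⟧, s⟦n⟧', P.le_shift n _ hQ, hs.shift n⟩⟩⟩
  have : (leftResolved E P).IsTriangulatedClosed₃ := .mk' fun T hT ⟨Q₁, s₁, hQ₁, hs₁⟩
      ⟨Q₂, s₂, hQ₂, hs₂⟩ ↦ by
    have h' := h _ hQ₁
    rw [← ObjectProperty.isColocal_trW] at h'
    obtain ⟨f, hf⟩ := (h' _ hs₂).2 (s₁ ≫ T.mor₁)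
    obtain ⟨Q₃, hQ₃, g, k, hT'⟩ := P.distinguished_cocone_triangle f hQ₁ hQ₂
    obtain ⟨c, hc, -⟩ := MorphismProperty.compatible_with_triangulation (W := E.trW) _ _ hT' hT
      s₁ s₂ hs₁ hs₂ hf
    exact ⟨Q₃, c, hQ₃, hc⟩
  exact { toIsTriangulatedClosed₂ := .of_isTriangulatedClosed₃ }

variable {E P} in
lemma rightResolved_isTriangulated (h : P ≤ E.rightOrthogonal) :
    (rightResolved E P).IsTriangulated := by
  have : (rightResolved E P).ContainsZero := by
    obtain ⟨Z, hZ, hZ'⟩ := P.exists_prop_of_containsZero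
    exact ⟨Z, hZ, Z, 𝟙 Z, hZ', E.trW_of_isIso _⟩
  have : (rightResolved E P).IsStableUnderShift ℤ := ⟨fun n ↦ ⟨fun X ⟨Q, s, hQ, hs⟩ ↦
    ⟨Q⟦n⟧, s⟦n⟧', P.le_shift n _ hQ, hs.shift n⟩⟩⟩
  have : (rightResolved E P).IsTriangulatedClosed₃ := .mk' fun T hT ⟨Q₁, s₁, hQ₁, hs₁⟩
      ⟨Q₂, s₂, hQ₂, hs₂⟩ ↦ by
    have h' := h _ hQ₂
    rw [← ObjectProperty.isLocal_trW] at h'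
    obtain ⟨f, hf⟩ := (h' _ hs₁).2 (T.mor₁ ≫ s₂)
    obtain ⟨Q₃, hQ₃, g, k, hT'⟩ := P.distinguished_cocone_triangle f hQ₁ hQ₂
    obtain ⟨c, hc, -⟩ := MorphismProperty.compatible_with_triangulation (W := E.trW) _ _ hT hT'
      s₁ s₂ hs₁ hs₂ hf.symm
    exact ⟨Q₃, c, hQ₃, hc⟩
  exact { toIsTriangulatedClosed₂ := .of_isTriangulatedClosed₃ }

end Resolved

section FullyFaithful

variable (E A P : ObjectProperty C) [E.IsTriangulated] [E.IsClosedUnderIsomorphisms]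
  [A.IsTriangulated]

/-- Pairs of morphisms from an object in `P` to objects in `A` factor through a common morphism
with cone in `E` and target in `A`. -/
def LeftFactors : Prop := ∀ ⦃Q Y Z : C⦄ (f : Q ⟶ Y) (g : Q ⟶ Z), P Q → A Y → A Z →
  ∃ (X : C) (p : Q ⟶ X) (a : X ⟶ Y) (b : X ⟶ Z), A X ∧ E.trW p ∧ p ≫ a = f ∧ p ≫ b = g

/-- Pairs of morphisms to an object in `P` from objects in `A` factor through a common morphism
with cone in `E` and source in `A`. -/
def RightFactors : Prop := ∀ ⦃Q Y Z : C⦄ (f : Y ⟶ Q) (g : Z ⟶ Q), P Q → A Y → A Z →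
  ∃ (X : C) (p : X ⟶ Q) (a : Y ⟶ X) (b : Z ⟶ X), A X ∧ E.trW p ∧ a ≫ p = f ∧ b ≫ p = g

variable {D₁ D : Type*} [Category* D₁] [Category* D] (L₁ : A.FullSubcategory ⥤ D₁)
  [L₁.IsLocalization (E.inverseImage A.ι).trW] (L : C ⥤ D) [L.IsLocalization E.trW]
  {F : D₁ ⥤ D}

variable {E A P}

/-- Composed with a resolution `s : Q ⟶ X`, a morphism of the big quotient comes from some `f : Q ⟶
Y` in `C`. Factoring `f` and `s` together through an object of `A` replaces the fraction by one
inside `A`; its denominator has cone in `E` by two out of three. -/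
lemma full_of_leftFactors (e : L₁ ⋙ F ≅ A.ι ⋙ L)
    (hP : P ≤ E.leftOrthogonal) (hA : A ≤ leftResolved E P)
    (hfac : LeftFactors E A P) : F.Full := by
  have : L₁.EssSurj := Localization.essSurj L₁ (E.inverseImage A.ι).trW
  refine F.full_of_comp_essSurj L₁ fun X Y φ ↦ ?_
  obtain ⟨Q, s, hQ, hs⟩ := hA _ X.property
  obtain ⟨f, hf⟩ := ((hP _ hQ).map_bijective_of_isTriangulated L Y.obj).2
    (L.map s ≫ e.inv.app X ≫ φ ≫ e.hom.app Y)
  obtain ⟨X', p, f', s', hX', hp, rfl, rfl⟩ := hfac f s hQ Y.property X.property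
  let t : (⟨X', hX'⟩ : A.FullSubcategory) ⟶ X := A.homMk s'
  let g : (⟨X', hX'⟩ : A.FullSubcategory) ⟶ Y := A.homMk f'
  have ht : (E.inverseImage A.ι).trW t :=
    (E.inverseImage_trW_iff A.ι t).2 (trW_of_precomp E hp hs)
  have := Localization.inverts L₁ _ t ht
  have := Localization.inverts L _ p hp
  have h1 : L.map g.hom = L.map t.hom ≫ e.inv.app X ≫ φ ≫ e.hom.app Y := by
    rw [← cancel_epi (L.map p)]
    change L.map p ≫ L.map f' = L.map p ≫ L.map s' ≫ _
    rw [← L.map_comp, hf, L.map_comp, Category.assoc]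
  refine ⟨inv (L₁.map t) ≫ L₁.map g, ?_⟩
  rw [F.map_comp, F.map_inv, IsIso.inv_comp_eq, ← cancel_mono (e.hom.app Y)]
  have h2 := e.hom.naturality t
  have h3 := e.hom.naturality g
  dsimp at h2 h3 ⊢
  rw [h3, Category.assoc, h1, ← reassoc_of% h2]
  simp

lemma full_of_rightFactors (e : L₁ ⋙ F ≅ A.ι ⋙ L)
    (hP : P ≤ E.rightOrthogonal) (hA : A ≤ rightResolved E P)
    (hfac : RightFactors E A P) : F.Full := by
  have : L₁.EssSurj := Localization.essSurj L₁ (E.inverseImage A.ι).trW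
  refine F.full_of_comp_essSurj L₁ fun X Y φ ↦ ?_
  obtain ⟨Q, s, hQ, hs⟩ := hA _ Y.property
  obtain ⟨f, hf⟩ := ((hP _ hQ).map_bijective_of_isTriangulated L X.obj).2
    (e.inv.app X ≫ φ ≫ e.hom.app Y ≫ L.map s)
  obtain ⟨X', p, f', s', hX', hp, rfl, rfl⟩ := hfac f s hQ X.property Y.property
  let t : Y ⟶ (⟨X', hX'⟩ : A.FullSubcategory) := A.homMk s'
  let g : X ⟶ (⟨X', hX'⟩ : A.FullSubcategory) := A.homMk f'
  have ht : (E.inverseImage A.ι).trW t :=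
    (E.inverseImage_trW_iff A.ι t).2 (trW_of_postcomp E hp hs)
  have := Localization.inverts L₁ _ t ht
  have := Localization.inverts L _ p hp
  have h1 : L.map g.hom = e.inv.app X ≫ φ ≫ e.hom.app Y ≫ L.map t.hom := by
    rw [← cancel_mono (L.map p)]
    change L.map f' ≫ L.map p = (_ ≫ _ ≫ _ ≫ L.map s') ≫ L.map p
    rw [← L.map_comp, hf, L.map_comp]
    simp
  refine ⟨L₁.map g ≫ inv (L₁.map t), ?_⟩
  rw [F.map_comp, F.map_inv, IsIso.comp_inv_eq, ← cancel_mono (e.hom.app _)]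
  have h2 := e.hom.naturality t
  have h3 := e.hom.naturality g
  dsimp at h2 h3 ⊢
  rw [h3, Category.assoc, h1, h2]
  simp

variable [Preadditive D₁] [Preadditive D] [L₁.Additive] [L.Additive]

/-- If `f` in `A` dies in the big quotient, orthogonality gives `s ≫ f = 0` for a resolution `s`. So
`s` factors through the fibre of `f`, which lies in `A`; replacing `Q` by an object of `A` gives a
map `t` of `A` with cone in `E` and `t ≫ f = 0`. -/
lemma faithful_of_leftFactors (e : L₁ ⋙ F ≅ A.ι ⋙ L)
    (hP : P ≤ E.leftOrthogonal) (hA : A ≤ leftResolved E P)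
    (hfac : LeftFactors E A P) : F.Faithful := by
  have : F.Additive := by
    rw [Localization.functor_additive_iff L₁ (E.inverseImage A.ι).trW]
    exact Functor.additive_of_iso e.symm
  refine Functor.faithful_of_comp_cancel_zero_of_hasLeftCalculusOfFractions L₁
    (E.inverseImage A.ι).trW F (fun X Y f hf ↦ ?_)
  have hf' : L.map f.hom = 0 := by
    have := e.hom.naturality f
    dsimp at this
    rw [hf, zero_comp] at this
    rw [← cancel_epi (e.hom.app X), comp_zero, this]
  obtain ⟨Q, s, hQ, hs⟩ := hA _ X.property
  have hsf : s ≫ f.hom = 0 :=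
    ((hP _ hQ).map_bijective_of_isTriangulated L Y.obj).1 (by
      rw [L.map_comp, hf', comp_zero, L.map_zero])
  obtain ⟨Z, hZ, z, w, hT⟩ := A.distinguished_cocone_triangle₁ f.hom X.property Y.property
  obtain ⟨q, hq⟩ : ∃ q : Q ⟶ Z, s = q ≫ z := Triangle.coyoneda_exact₂ _ hT s hsf
  -- One map has to be factored here, so the pair is taken constant.
  obtain ⟨X', p, q', -, hX', hp, hpq, -⟩ := hfac q q hQ hZ hZ
  let t : (⟨X', hX'⟩ : A.FullSubcategory) ⟶ X := A.homMk (q' ≫ z)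
  have ht : (E.inverseImage A.ι).trW t := by
    refine (E.inverseImage_trW_iff A.ι t).2 (trW_of_precomp E hp ?_)
    change E.trW (p ≫ q' ≫ z)
    rwa [reassoc_of% hpq, ← hq]
  have := Localization.inverts L₁ _ t ht
  have htf : t ≫ f = 0 := by
    ext
    change (q' ≫ z) ≫ f.hom = 0
    rw [Category.assoc]
    exact (congrArg (q' ≫ ·) (comp_distTriang_mor_zero₁₂ _ hT)).trans comp_zero
  rw [← cancel_epi (L₁.map t), ← L₁.map_comp, htf, L₁.map_zero, comp_zero]

lemma faithful_of_rightFactors (e : L₁ ⋙ F ≅ A.ι ⋙ L)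
    (hP : P ≤ E.rightOrthogonal) (hA : A ≤ rightResolved E P)
    (hfac : RightFactors E A P) : F.Faithful := by
  have : F.Additive := by
    rw [Localization.functor_additive_iff L₁ (E.inverseImage A.ι).trW]
    exact Functor.additive_of_iso e.symm
  refine Functor.faithful_of_comp_cancel_zero_of_hasLeftCalculusOfFractions L₁
    (E.inverseImage A.ι).trW F (fun X Y f hf ↦ ?_)
  have hf' : L.map f.hom = 0 := by
    have := e.hom.naturality f
    dsimp at this
    rw [hf, zero_comp] at this
    rw [← cancel_epi (e.hom.app X), comp_zero, this]
  obtain ⟨Q, s, hQ, hs⟩ := hA _ Y.property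
  have hsf : f.hom ≫ s = 0 :=
    ((hP _ hQ).map_bijective_of_isTriangulated L X.obj).1 (by
      rw [L.map_comp, hf', zero_comp, L.map_zero])
  obtain ⟨Z, hZ, z, w, hT⟩ := A.distinguished_cocone_triangle f.hom X.property Y.property
  obtain ⟨q, hq⟩ : ∃ q : Z ⟶ Q, s = z ≫ q := Triangle.yoneda_exact₂ _ hT s hsf
  obtain ⟨X', p, q', -, hX', hp, hpq, -⟩ := hfac q q hQ hZ hZ
  let t : Y ⟶ (⟨X', hX'⟩ : A.FullSubcategory) := A.homMk (z ≫ q')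
  have ht : (E.inverseImage A.ι).trW t := by
    refine (E.inverseImage_trW_iff A.ι t).2 (trW_of_postcomp E hp ?_)
    change E.trW ((z ≫ q') ≫ p)
    rwa [Category.assoc, hpq, ← hq]
  have := Localization.inverts L₁ _ t ht
  have htf : f ≫ t = 0 := by
    ext
    change f.hom ≫ z ≫ q' = 0
    rw [← Category.assoc]
    exact (congrArg (· ≫ q') (comp_distTriang_mor_zero₁₂ _ hT)).trans zero_comp
  rw [← cancel_mono (L₁.map t), ← L₁.map_comp, htf, L₁.map_zero, zero_comp]

end FullyFaithful

end Verdier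

/-! ### Triangle equivalence through a common essential image -/

section TriangleEquivalent

variable {D₁ D₂ D : Type*} [Category* D₁] [Category* D₂] [Category* D] [HasZeroObject D₁]
  [HasZeroObject D₂] [HasZeroObject D] [Preadditive D₁] [Preadditive D₂] [Preadditive D]
  [HasShift D₁ ℤ] [HasShift D₂ ℤ] [HasShift D ℤ] [∀ n : ℤ, (shiftFunctor D₁ n).Additive]
  [∀ n : ℤ, (shiftFunctor D₂ n).Additive] [∀ n : ℤ, (shiftFunctor D n).Additive]
  [Pretriangulated D₁] [Pretriangulated D₂] [Pretriangulated D]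

lemma triangleEquivalent_inverse (G : D₂ ⥤ D) [hG : G.CommShift ℤ] [hG' : G.IsTriangulated]
    [G.IsEquivalence] : TriangleEquivalent D D₂ := by
  let _ : G.asEquivalence.functor.CommShift ℤ := hG
  have : G.asEquivalence.functor.IsTriangulated := hG'
  let _ := G.asEquivalence.commShiftInverse ℤ
  have := G.asEquivalence.commShift_of_functor ℤ
  exact ⟨G.asEquivalence.inverse, inferInstance, inferInstance,
    G.asEquivalence.toAdjunction.isTriangulated_rightAdjoint⟩

/-- Two triangulated categories with fully faithful triangulated functors to a third one
with the same essential image are triangle equivalent. -/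
lemma triangleEquivalent_of_essImage_eq (F₁ : D₁ ⥤ D) (F₂ : D₂ ⥤ D) [F₁.CommShift ℤ]
    [F₂.CommShift ℤ] [F₁.IsTriangulated] [F₂.IsTriangulated] [F₁.Full] [F₁.Faithful]
    [F₂.Full] [F₂.Faithful] (h : F₁.essImage = F₂.essImage) : TriangleEquivalent D₁ D₂ := by
  have h₁ (X : D₁) : F₂.essImage (F₁.obj X) := by
    rw [← h]
    exact F₁.obj_mem_essImage X
  have h₂ (X : D₂) : F₂.essImage (F₂.obj X) := F₂.obj_mem_essImage X
  -- Both functors become equivalences onto the common essential image, a triangulated subcategory;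
  -- the second is then inverted.
  let G₁ : D₁ ⥤ F₂.essImage.FullSubcategory := F₂.essImage.lift F₁ h₁
  let G₂ : D₂ ⥤ F₂.essImage.FullSubcategory := F₂.essImage.lift F₂ h₂
  have : G₁.EssSurj := ⟨fun Y ↦ by
    obtain ⟨X, ⟨e⟩⟩ : F₁.essImage Y.obj := by
      rw [h]
      exact Y.property
    exact ⟨X, ⟨F₂.essImage.isoMk e⟩⟩⟩
  have : G₂.EssSurj := ⟨fun Y ↦ by
    obtain ⟨X, ⟨e⟩⟩ := Y.property
    exact ⟨X, ⟨F₂.essImage.isoMk e⟩⟩⟩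
  have : G₁.IsEquivalence := { }
  have : G₂.IsEquivalence := { }
  obtain ⟨G, _, _, _⟩ := triangleEquivalent_inverse G₂
  exact ⟨G₁ ⋙ G, inferInstance, inferInstance, inferInstance⟩

end TriangleEquivalent

/-! ### The formal equivalence between a Verdier quotient and a subcategory -/

section VerdierEquivalence

variable {C : Type*} [Category* C] [HasZeroObject C] [HasShift C ℤ] [Preadditive C]
  [∀ n : ℤ, (shiftFunctor C n).Additive] [Pretriangulated C] [IsTriangulated C]
  {E A P : ObjectProperty C} [E.IsTriangulated] [E.IsClosedUnderIsomorphisms]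
  [A.IsTriangulated] [P.IsTriangulated] {D₁ : Type*} [Category* D₁]
  [HasZeroObject D₁] [Preadditive D₁] [HasShift D₁ ℤ] [∀ n : ℤ, (shiftFunctor D₁ n).Additive]
  [Pretriangulated D₁]

/-- The quotient of `A` and the subcategory `P` both embed in the quotient of `C` by `E`. The images
agree: an object of `A` is isomorphic there to its resolution in `P`, and an object of `P` to the
object of `A` supplied by `hfac`. -/
lemma triangleEquivalent_of_leftFactors (L₁ : A.FullSubcategory ⥤ D₁)
    [L₁.IsLocalization (E.inverseImage A.ι).trW] [L₁.CommShift ℤ] [L₁.IsTriangulated]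
    (hP : P ≤ E.leftOrthogonal) (hA : A ≤ leftResolved E P)
    (hfac : LeftFactors E A P) : TriangleEquivalent D₁ P.FullSubcategory := by
  let L := E.trW.Q
  let F : D₁ ⥤ E.trW.Localization :=
    Localization.lift (A.ι ⋙ L) (E.inverseImage_trW_isInverted A.ι L) L₁
  let e : L₁ ⋙ F ≅ A.ι ⋙ L := Localization.fac _ _ _
  have := full_of_leftFactors L₁ L e hP hA hfac
  have := faithful_of_leftFactors L₁ L e hP hA hfac
  let _ : F.CommShift ℤ :=
    Functor.commShiftOfLocalization L₁ (E.inverseImage A.ι).trW ℤ (A.ι ⋙ L) F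
  have : NatTrans.CommShift e.hom ℤ :=
    NatTrans.commShift_iso_hom_of_localization L₁ (E.inverseImage A.ι).trW ℤ (A.ι ⋙ L) F
  have : L₁.mapArrow.EssSurj := Localization.essSurj_mapArrow L₁ (E.inverseImage A.ι).trW
  have : F.IsTriangulated := Functor.isTriangulated_of_precomp_iso e
  have hff (X : P.FullSubcategory) (Y : P.FullSubcategory) :
      Function.Bijective ((P.ι ⋙ L).map : (X ⟶ Y) → _) :=
    ((hP _ X.property).map_bijective_of_isTriangulated L Y.obj).comp
      (P.fullyFaithfulι.map_bijective X Y)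
  have : (P.ι ⋙ L).Full := ⟨fun {X Y} ↦ (hff X Y).2⟩
  have : (P.ι ⋙ L).Faithful := ⟨fun {X Y} ↦ @(hff X Y).1⟩
  refine triangleEquivalent_of_essImage_eq F (P.ι ⋙ L) ?_
  have : L₁.EssSurj := Localization.essSurj L₁ (E.inverseImage A.ι).trW
  ext Z
  constructor
  · rintro ⟨X, ⟨i⟩⟩
    obtain ⟨Q, s, hQ, hs⟩ := hA _ (L₁.objPreimage X).property
    have := Localization.inverts L _ s hs
    exact ⟨⟨Q, hQ⟩, ⟨asIso (L.map s) ≪≫ (e.app (L₁.objPreimage X)).symm ≪≫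
      F.mapIso (L₁.objObjPreimageIso X) ≪≫ i⟩⟩
  · rintro ⟨Q, ⟨i⟩⟩
    obtain ⟨Y, -, hY⟩ := A.exists_prop_of_containsZero
    -- Only `p` is wanted, so the pair of maps to be factored may be zero.
    obtain ⟨X, p, -, -, hX, hp, -⟩ := hfac (0 : Q.obj ⟶ Y) (0 : Q.obj ⟶ Y) Q.property hY hY
    have := Localization.inverts L _ p hp
    exact ⟨L₁.obj ⟨X, hX⟩, ⟨e.app ⟨X, hX⟩ ≪≫ (asIso (L.map p)).symm ≪≫ i⟩⟩

lemma triangleEquivalent_of_rightFactors (L₁ : A.FullSubcategory ⥤ D₁)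
    [L₁.IsLocalization (E.inverseImage A.ι).trW] [L₁.CommShift ℤ] [L₁.IsTriangulated]
    (hP : P ≤ E.rightOrthogonal)
    (hA : A ≤ rightResolved E P) (hfac : RightFactors E A P) :
    TriangleEquivalent D₁ P.FullSubcategory := by
  let L := E.trW.Q
  let F : D₁ ⥤ E.trW.Localization :=
    Localization.lift (A.ι ⋙ L) (E.inverseImage_trW_isInverted A.ι L) L₁
  let e : L₁ ⋙ F ≅ A.ι ⋙ L := Localization.fac _ _ _
  have := full_of_rightFactors L₁ L e hP hA hfac
  have := faithful_of_rightFactors L₁ L e hP hA hfac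
  let _ : F.CommShift ℤ :=
    Functor.commShiftOfLocalization L₁ (E.inverseImage A.ι).trW ℤ (A.ι ⋙ L) F
  have : NatTrans.CommShift e.hom ℤ :=
    NatTrans.commShift_iso_hom_of_localization L₁ (E.inverseImage A.ι).trW ℤ (A.ι ⋙ L) F
  have : L₁.mapArrow.EssSurj := Localization.essSurj_mapArrow L₁ (E.inverseImage A.ι).trW
  have : F.IsTriangulated := Functor.isTriangulated_of_precomp_iso e
  have hff (X : P.FullSubcategory) (Y : P.FullSubcategory) :
      Function.Bijective ((P.ι ⋙ L).map : (X ⟶ Y) → _) :=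
    ((hP _ Y.property).map_bijective_of_isTriangulated L X.obj).comp
      (P.fullyFaithfulι.map_bijective X Y)
  have : (P.ι ⋙ L).Full := ⟨fun {X Y} ↦ (hff X Y).2⟩
  have : (P.ι ⋙ L).Faithful := ⟨fun {X Y} ↦ @(hff X Y).1⟩
  refine triangleEquivalent_of_essImage_eq F (P.ι ⋙ L) ?_
  have : L₁.EssSurj := Localization.essSurj L₁ (E.inverseImage A.ι).trW
  ext Z
  constructor
  · rintro ⟨X, ⟨i⟩⟩
    obtain ⟨Q, s, hQ, hs⟩ := hA _ (L₁.objPreimage X).property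
    have := Localization.inverts L _ s hs
    exact ⟨⟨Q, hQ⟩, ⟨(asIso (L.map s)).symm ≪≫ (e.app (L₁.objPreimage X)).symm ≪≫
      F.mapIso (L₁.objObjPreimageIso X) ≪≫ i⟩⟩
  · rintro ⟨Q, ⟨i⟩⟩
    obtain ⟨Y, -, hY⟩ := A.exists_prop_of_containsZero
    obtain ⟨X, p, -, -, hX, hp, -⟩ := hfac (0 : Y ⟶ Q.obj) (0 : Y ⟶ Q.obj) Q.property hY hY
    have := Localization.inverts L _ p hp
    exact ⟨L₁.obj ⟨X, hX⟩, ⟨e.app ⟨X, hX⟩ ≪≫ asIso (L.map p) ≪≫ i⟩⟩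

end VerdierEquivalence

/-! ### Null-homotopies built degree by degree -/

section NullHomotopic

open CochainComplex HomComplex Opposite

variable {C : Type*} [Category* C] [Preadditive C]

/-- The inductive step. The defect `u` of the partial homotopy in degree `n + 1` is killed by
precomposition with the differential of `K`, so it factors through the next differential. The factor
is added as a new component; it does not affect degrees up to `n`. -/
lemma exists_cochain_eqUpTo {K L : CochainComplex C ℤ} (f : K ⟶ L) (α : Cochain K L (-1))
    (n m : ℤ) (hnm : n + 1 = m)
    (hK : ∀ (i k : ℤ), i + 1 = m → m + 1 = k → ∀ g : K.X m ⟶ L.X m, K.d i m ≫ g = 0 →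
      ∃ g' : K.X k ⟶ L.X m, K.d m k ≫ g' = g)
    (hα : (δ (-1) 0 α).EqUpTo (Cochain.ofHom f) n) :
    ∃ (h : K.X (n + 2) ⟶ L.X (n + 1)),
      (δ (-1) 0 (α + Cochain.single h (-1))).EqUpTo (Cochain.ofHom f) m := by
  subst hnm
  let u := f.f (n + 1) - α.v (n + 1) n (by lia) ≫ L.d n (n + 1) -
    K.d (n + 1) (n + 2) ≫ α.v (n + 2) (n + 1) (by lia)
  have hu : K.d n (n + 1) ≫ u = 0 := by
    have eq := hα n n (add_zero n) (by rfl)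
    simp only [δ_v (-1) 0 (neg_add_cancel 1) α n n (add_zero _) (n - 1) (n + 1)
      (by lia) (by lia), Int.negOnePow_zero, one_smul, Cochain.ofHom_v] at eq
    simp only [u, Preadditive.comp_sub, HomologicalComplex.d_comp_d_assoc, zero_comp,
      ← f.comm, ← eq, Preadditive.add_comp, Category.assoc, L.d_comp_d, comp_zero, zero_add,
      sub_self]
  obtain ⟨β, hβ⟩ : ∃ (β : K.X (n + 2) ⟶ L.X (n + 1)), K.d (n + 1) (n + 2) ≫ β = u :=
    hK n (n + 2) rfl (by lia) u hu
  refine ⟨β, ?_⟩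
  intro p q hpq hp
  obtain rfl : p = q := by lia
  obtain hp | rfl := hp.lt_or_eq
  · rw [δ_add, Cochain.add_v, hα p p (by lia) (by lia), add_eq_left,
      δ_v (-1) 0 (neg_add_cancel 1) _ p p hpq (p - 1) (p + 1) rfl rfl,
      Cochain.single_v_eq_zero _ _ _ _ _ (by lia),
      Cochain.single_v_eq_zero _ _ _ _ _ (by lia)]
    simp
  · rw [δ_v (-1) 0 (neg_add_cancel 1) _ (n + 1) (n + 1) (by lia) n (n + 2)
      (by lia) (by lia), Cochain.add_v,
      Cochain.single_v_eq_zero _ _ _ _ _ (by lia)]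
    simp [hβ, u]

open Cochain.InductionUp in
/-- A morphism of complexes `K ⟶ L` with `L` bounded below is homotopic to zero if the complexes
of morphisms from `K` to the terms of `L` are exact. -/
lemma nonempty_homotopy_zero_of_isStrictlyGE {K L : CochainComplex C ℤ} (d : ℤ)
    [L.IsStrictlyGE d]
    (hK : ∀ (i j k : ℤ), i + 1 = j → j + 1 = k → ∀ g : K.X j ⟶ L.X j, K.d i j ≫ g = 0 →
      ∃ g' : K.X k ⟶ L.X j, K.d j k ≫ g' = g) (f : K ⟶ L) : Nonempty (Homotopy f 0) := by
  let X (n : ℕ) : Set (Cochain K L (-1)) :=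
    Set.ofPred (fun α => (δ (-1) 0 α).EqUpTo (Cochain.ofHom f) (n + d - 1))
  -- The zero cochain works below degree `d`, where `L` vanishes.
  let x₀ : X 0 := ⟨0, fun p q hpq hp ↦
    IsZero.eq_of_tgt (L.isZero_of_isStrictlyGE d _ (by lia)) _ _⟩
  let φ (n : ℕ) (α : X n) : X (n + 1) :=
    ⟨_, (exists_cochain_eqUpTo f α.1 (n + d - 1) ((n + 1 : ℕ) + d - 1)
      (by lia) (fun i k ↦ hK i _ k) α.2).choose_spec⟩
  have hφ (k : ℕ) (x : X k) : (φ k x).1.EqUpTo x.1 (d + k) := fun p q hpq hp => by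
    dsimp [φ]
    rw [add_eq_left, Cochain.single_v_eq_zero _ _ _ _ _ (by lia)]
  refine ⟨(Cochain.equivHomotopy f 0).symm ⟨limitSequence φ hφ x₀, ?_⟩⟩
  rw [Cochain.ofHom_zero, add_zero]
  ext n
  -- This stage is already correct in degree `n`, and the later ones only alter components whose
  -- source has degree greater than `n + 1`.
  let k₀ := (n - d + 1).toNat
  rw [← (sequence φ x₀ k₀).2 n n (add_zero n) (by lia),
    δ_v (-1) 0 (neg_add_cancel 1) _ n n (by lia) (n - 1) (n + 1) rfl (by lia),
    δ_v (-1) 0 (neg_add_cancel 1) _ n n (by lia) (n - 1) (n + 1) rfl (by lia),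
    limitSequence_eqUpTo φ hφ x₀ k₀ n (n - 1) (by lia) (by lia),
    limitSequence_eqUpTo φ hφ x₀ k₀ (n + 1) n (by lia) (by lia)]

/-- A morphism of complexes `K ⟶ L` with `K` bounded above is homotopic to zero if the complexes
of morphisms from the terms of `K` to `L` are exact. -/
lemma nonempty_homotopy_zero_of_isStrictlyLE {K L : CochainComplex C ℤ} (d : ℤ)
    [K.IsStrictlyLE d]
    (hL : ∀ (i j k : ℤ), i + 1 = j → j + 1 = k → ∀ g : K.X j ⟶ L.X j, g ≫ L.d j k = 0 →
      ∃ g' : K.X j ⟶ L.X i, g' ≫ L.d i j = g) (f : K ⟶ L) : Nonempty (Homotopy f 0) := by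
  have : ((opEquivalence C).functor.obj (op K)).IsStrictlyGE (-d) := by
    rw [isStrictlyGE_iff]
    intro i hi
    exact (K.isZero_of_isStrictlyLE d (-i) (by lia)).op
  obtain ⟨h⟩ := nonempty_homotopy_zero_of_isStrictlyGE (-d) (fun i j k hi hk g hg ↦ by
    obtain ⟨g', hg'⟩ := hL (-k) (-j) (-i) (by lia) (by lia) g.unop (Quiver.Hom.op_inj hg)
    exact ⟨g'.op, Quiver.Hom.unop_inj hg'⟩) ((opEquivalence C).functor.map f.op)
  exact ⟨homotopyUnop (h.trans (.ofEq (by simp)))⟩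

end NullHomotopic

/-! ### Orthogonality to the pure exact complexes -/

section Orthogonal

variable {R : Type u} [Ring R]

/-- The map `g` lands in the kernel of `X.d j k`, onto which `X.X i` maps by a pure epimorphism. -/
lemma IsPureProjective.exists_lift {P : ModuleCat.{u} R} (hP : IsPureProjective P)
    {X : CochainComplex (ModuleCat.{u} R) ℤ} (hX : ∀ n, TensorExactAt X n) {i j k : ℤ}
    (hi : i + 1 = j) (hk : j + 1 = k) (g : P ⟶ X.X j) (hg : g ≫ X.d j k = 0) :
    ∃ g' : P ⟶ X.X i, g' ≫ X.d i j = g := by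
  obtain ⟨A, f, w, h⟩ := isPureEpi_lift (i := i - 1) (by lia) hi hk (hX _) (hX _) (hX _)
  obtain ⟨g', hg'⟩ := hP _ h (kernel.lift _ g hg)
  refine ⟨g', ?_⟩
  rw [← kernel.lift_ι (X.d j k) g hg, ← hg']
  exact (Category.assoc _ _ _ |>.trans (congrArg (g' ≫ ·) (kernel.lift_ι _ _ _))).symm

/-- By exactness `g` descends to the image of `X.d j k`, which is the kernel of the next
differential; this kernel is pure in `X.X k`, so the map extends. -/
lemma IsPureInjective.exists_desc {I : ModuleCat.{u} R} (hI : IsPureInjective I)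
    {X : CochainComplex (ModuleCat.{u} R) ℤ} (hX : ∀ n, TensorExactAt X n) {i j k : ℤ}
    (hi : i + 1 = j) (hk : j + 1 = k) (g : X.X j ⟶ I) (hg : X.d i j ≫ g = 0) :
    ∃ g' : X.X k ⟶ I, X.d j k ≫ g' = g := by
  let p := kernel.lift (X.d k (k + 1)) (X.d j k) (X.d_comp_d _ _ _)
  obtain ⟨A, f, w, h⟩ : IsPureEpi p := isPureEpi_lift hi hk rfl (hX _) (hX _) (hX _)
  have := h.shortExact.epi_g
  have hfg : f ≫ g = 0 := by
    ext a
    obtain ⟨x, hx⟩ := (hX j).exact i k hi hk (f a) (by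
      have : f ≫ X.d j k = 0 := by
        rw [← kernel.lift_ι (X.d k (k + 1)) (X.d j k) (X.d_comp_d _ _ _), reassoc_of% w,
          zero_comp]
      exact ConcreteCategory.congr_hom this a)
    change g (f a) = 0
    rw [← hx]
    exact ConcreteCategory.congr_hom hg x
  obtain ⟨C, q, w', h'⟩ := isPureMono_kernel (k := k + 1) hk rfl (hX j) (hX k)
  obtain ⟨g', hg'⟩ := hI _ h' (h.shortExact.exact.desc g hfg)
  refine ⟨g', ?_⟩
  rw [← kernel.lift_ι (X.d k (k + 1)) (X.d j k) (X.d_comp_d _ _ _), Category.assoc]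
  exact (congrArg (p ≫ ·) hg').trans (h.shortExact.exact.g_desc g hfg)

variable (R)

lemma minusPP_le_leftOrthogonal : minusPP R ≤ (pureExact R).leftOrthogonal := by
  rintro X ⟨⟨n, _⟩, hX⟩ Y f hY
  obtain ⟨f : X.as ⟶ Y.as, rfl⟩ := (HomotopyCategory.quotient _ _).map_surjective f
  rw [pureExact_iff] at hY
  obtain ⟨h⟩ := nonempty_homotopy_zero_of_isStrictlyLE n
    (fun i j k hi hk g hg ↦ (hX j).exists_lift hY hi hk g hg) f
  exact (HomotopyCategory.eq_of_homotopy _ _ h).trans (Functor.map_zero _ _ _)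

lemma plusPI_le_rightOrthogonal : plusPI R ≤ (pureExact R).rightOrthogonal := by
  rintro X ⟨⟨n, _⟩, hX⟩ Y f hY
  obtain ⟨f : Y.as ⟶ X.as, rfl⟩ := (HomotopyCategory.quotient _ _).map_surjective f
  rw [pureExact_iff] at hY
  obtain ⟨h⟩ := nonempty_homotopy_zero_of_isStrictlyGE n
    (fun i j k hi hk g hg ↦ (hX j).exists_desc hY hi hk g hg) f
  exact (HomotopyCategory.eq_of_homotopy _ _ h).trans (Functor.map_zero _ _ _)

end Orthogonal

/-! ### Canonical truncation away from the boundary degree -/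

section Embedding

variable {ι ι' : Type*} {c : ComplexShape ι} {c' : ComplexShape ι'} {C : Type*} [Category* C]
  [HasZeroMorphisms C] [HasZeroObject C] (K : HomologicalComplex C c') (e : c.Embedding c')
  [e.IsTruncGE] [∀ i', K.HasHomology i']

lemma isIso_embedding_πTruncGE_f {i : ι} {i' : ι'} (hi : e.f i = i') (h : ¬ e.BoundaryGE i) :
    IsIso ((K.πTruncGE e).f i') :=
  (e.isIso_liftExtend_f_iff (K.restrictionToTruncGE' e) (K.restrictionToTruncGE'_hasLift e) hi).2
    (K.isIso_restrictionToTruncGE' e i h)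

end Embedding

/-! ### Truncations with pure exact cone -/

section Truncation

variable {R : Type u} [Ring R] {X Y : CochainComplex (ModuleCat.{u} R) ℤ}

/-- Tensoring commutes with mapping cones, and the cone of a quasi-isomorphism is acyclic. -/
lemma trW_quotient_map (f : X ⟶ Y)
    (hf : ∀ M, QuasiIso (((tensorFunctor M).mapHomologicalComplex _).map f)) :
    (pureExact R).trW ((HomotopyCategory.quotient _ _).map f) := by
  refine .mk _ (HomotopyCategory.mappingCone_triangleh_distinguished f) ?_
  rw [pureExact_iff]
  intro n M
  let φ := ((tensorFunctor M).mapHomologicalComplex _).map f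
  have h : (CochainComplex.mappingCone φ).ExactAt n := by
    refine (HomotopyCategory.quotient_obj_mem_subcategoryAcyclic_iff_exactAt _).1
      (((HomotopyCategory.subcategoryAcyclic _).trW_iff_of_distinguished _
        (HomotopyCategory.mappingCone_triangleh_distinguished φ)).1 ?_) n
    rw [← HomotopyCategory.quasiIso_eq_trW_subcategoryAcyclic]
    exact HomotopyCategory.quotient_map_mem_quasiIso_iff φ |>.2 (hf M)
  exact h.of_iso (CochainComplex.mappingCone.mapHomologicalComplexIso f (tensorFunctor M)).symm

lemma tensorExactAt_of_isZero_X {n : ℤ} (h : IsZero (X.X n)) : TensorExactAt X n := fun M ↦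
  ShortComplex.exact_of_isZero_X₂ _ ((tensorFunctor M).map_isZero h)

lemma quasiIso_tensor_of_surjective (f : X ⟶ Y) (m : ℤ)
    (hX : ∀ i ≤ m, TensorExactAt X i) (hY : ∀ i ≤ m, TensorExactAt Y i)
    (hf : ∀ i, Function.Surjective (f.f i)) (hf' : ∀ i > m, IsIso (f.f i))
    (M : ModuleCat.{u} Rᵐᵒᵖ) :
    QuasiIso (((tensorFunctor M).mapHomologicalComplex _).map f) where
  quasiIsoAt i := by
    by_cases hi : i ≤ m
    · rw [quasiIsoAt_iff_exactAt _ _ (hX i hi M)]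
      exact hY i hi M
    · rw [quasiIsoAt_iff' _ (i - 1) i (i + 1) (by simp) (by simp)]
      have := hf' i (by lia)
      have := hf' (i + 1) (by lia)
      let φ := (HomologicalComplex.shortComplexFunctor' _ _ (i - 1) i (i + 1)).map
        (((tensorFunctor M).mapHomologicalComplex (.up ℤ)).map f)
      have : Epi φ.τ₁ := (AddCommGrpCat.epi_iff_surjective _).2
        (tensorFunctor_map_surjective M _ (hf (i - 1)))
      have : IsIso φ.τ₂ := inferInstanceAs (IsIso ((tensorFunctor M).map (f.f i)))
      have : IsIso φ.τ₃ := inferInstanceAs (IsIso ((tensorFunctor M).map (f.f (i + 1))))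
      exact ShortComplex.quasiIso_of_epi_of_isIso_of_mono φ

/-- Unlike surjectivity, injectivity does not survive tensoring, so it is assumed after applying `M
⊗_R -`. It is needed only in degree `m`, to compare homology in degree `m - 1`. -/
lemma quasiIso_tensor_of_injective (f : X ⟶ Y) (m : ℤ)
    (hX : ∀ i ≥ m, TensorExactAt X i) (hY : ∀ i ≥ m, TensorExactAt Y i)
    (M : ModuleCat.{u} Rᵐᵒᵖ) (hf : Function.Injective ((tensorFunctor M).map (f.f m)))
    (hf' : ∀ i < m, IsIso (f.f i)) :
    QuasiIso (((tensorFunctor M).mapHomologicalComplex _).map f) where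
  quasiIsoAt i := by
    by_cases hi : m ≤ i
    · rw [quasiIsoAt_iff_exactAt _ _ (hX i hi M)]
      exact hY i hi M
    · rw [quasiIsoAt_iff' _ (i - 1) i (i + 1) (by simp) (by simp)]
      have := hf' i (by lia)
      have := hf' (i - 1) (by lia)
      let φ := (HomologicalComplex.shortComplexFunctor' _ _ (i - 1) i (i + 1)).map
        (((tensorFunctor M).mapHomologicalComplex (.up ℤ)).map f)
      have : IsIso φ.τ₁ := inferInstanceAs (IsIso ((tensorFunctor M).map (f.f (i - 1))))
      have : IsIso φ.τ₂ := inferInstanceAs (IsIso ((tensorFunctor M).map (f.f i)))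
      have : Mono φ.τ₃ := by
        change Mono ((tensorFunctor M).map (f.f (i + 1)))
        obtain rfl | hi' := eq_or_ne m (i + 1)
        · exact (AddCommGrpCat.mono_iff_injective _).2 hf
        · have := hf' (i + 1) (by lia)
          infer_instance
      exact ShortComplex.quasiIso_of_epi_of_isIso_of_mono φ

lemma isIso_πTruncGE_f (m i : ℤ) (hi : m < i) : IsIso ((X.πTruncGE m).f i) := by
  have hi' : (ComplexShape.embeddingUpIntGE m).f (i - m).toNat = i := by
    simp; lia
  refine isIso_embedding_πTruncGE_f X _ hi' fun h ↦ ?_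
  rw [ComplexShape.boundaryGE_embeddingUpIntGE_iff] at h
  lia

lemma isIso_ιTruncLE_f (m i : ℤ) (hi : i < m) : IsIso ((X.ιTruncLE m).f i) := by
  have hi' : (ComplexShape.embeddingUpIntLE m).op.f (m - i).toNat = i := by
    simp; lia
  have : IsIso ((X.op.πTruncGE (ComplexShape.embeddingUpIntLE m).op).f i) := by
    refine isIso_embedding_πTruncGE_f X.op _ hi' fun h ↦ ?_
    rw [ComplexShape.Embedding.op_boundaryGE_iff,
      ComplexShape.boundaryLE_embeddingUpIntLE_iff] at h
    lia
  exact inferInstanceAs (IsIso ((X.op.πTruncGE (ComplexShape.embeddingUpIntLE m).op).f i).unop)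

/-- The truncation is tensor exact at its lowest degree `m`: a cycle lifts to `X`, stays a cycle
since the terms in degree `m + 1` agree, and is a boundary by exactness of `X`. -/
lemma quasiIso_tensor_πTruncGE (m : ℤ) (hX : ∀ i ≤ m, TensorExactAt X i)
    (M : ModuleCat.{u} Rᵐᵒᵖ) :
    QuasiIso (((tensorFunctor M).mapHomologicalComplex _).map (X.πTruncGE m)) := by
  have hepi (i : ℤ) : Function.Surjective ((X.πTruncGE m).f i) :=
    (ModuleCat.epi_iff_surjective _).1 (by dsimp [CochainComplex.πTruncGE]; infer_instance)
  refine quasiIso_tensor_of_surjective _ m hX (fun i hi ↦ ?_) hepi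
    (fun i hi ↦ isIso_πTruncGE_f m i hi) M
  obtain hi | rfl := hi.lt_or_eq
  · exact tensorExactAt_of_isZero_X (CochainComplex.isZero_of_isStrictlyGE _ m i hi)
  rw [tensorExactAt_iff _ (i - 1) i (i + 1) (by lia) rfl]
  intro N y hy
  obtain ⟨y, rfl⟩ := tensorFunctor_map_surjective N _ (hepi i) y
  have := isIso_πTruncGE_f (X := X) i (i + 1) (by lia)
  have h1 : Function.Injective ((tensorFunctor N).map ((X.πTruncGE i).f (i + 1))) :=
    (AddCommGrpCat.mono_iff_injective _).1 inferInstance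
  rw [← ConcreteCategory.comp_apply, ← Functor.map_comp, HomologicalComplex.Hom.comm,
    Functor.map_comp, ConcreteCategory.comp_apply] at hy
  obtain ⟨x, rfl⟩ := (tensorExactAt_iff X (i - 1) i (i + 1) (by lia) rfl).1 (hX i le_rfl) N y
    (h1 (hy.trans (map_zero _).symm))
  refine ⟨(tensorFunctor N).map ((X.πTruncGE i).f (i - 1)) x, ?_⟩
  rw [← ConcreteCategory.comp_apply, ← ConcreteCategory.comp_apply, ← Functor.map_comp,
    ← Functor.map_comp, HomologicalComplex.Hom.comm]

/-- The top term of the truncation is a kernel, covered by the term in degree `m - 1`. Exactness in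
degree `m - 1`, one below the cut, shows that this kernel stays embedded after tensoring: an element
that dies is the image of a boundary, hence zero. -/
lemma quasiIso_tensor_ιTruncLE (m : ℤ) (hX : ∀ i ≥ m - 1, TensorExactAt X i)
    (M : ModuleCat.{u} Rᵐᵒᵖ) :
    QuasiIso (((tensorFunctor M).mapHomologicalComplex _).map (X.ιTruncLE m)) := by
  have hiso (i : ℤ) (hi : i < m) := isIso_ιTruncLE_f (X := X) m i hi
  have hd : Function.Surjective ((X.truncLE m).d (m - 1) m) := by
    have h : (X.truncLE m).ExactAt m := by
      rw [← quasiIsoAt_iff_exactAt' (X.ιTruncLE m) m]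
      · infer_instance
      · rw [HomologicalComplex.exactAt_iff' _ (m - 1) m (m + 1) (by simp) (by simp),
          ShortComplex.moduleCat_exact_iff]
        exact fun y hy ↦ (hX m (by lia)).exact (m - 1) (m + 1) (by lia) rfl y hy
    rw [HomologicalComplex.exactAt_iff' _ (m - 1) m (m + 1) (by simp) (by simp),
      ShortComplex.moduleCat_exact_iff] at h
    exact fun y ↦ h y (ConcreteCategory.congr_hom
      ((CochainComplex.isZero_of_isStrictlyLE _ m (m + 1) (by lia)).eq_of_tgt
        ((X.truncLE m).d m (m + 1)) 0) y)
  refine quasiIso_tensor_of_injective _ m (fun i hi ↦ ?_) (fun i hi ↦ hX i (by lia)) M ?_ hiso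
  · obtain hi | rfl := hi.lt_or_eq
    · exact tensorExactAt_of_isZero_X (CochainComplex.isZero_of_isStrictlyLE _ m i hi)
    · rw [tensorExactAt_iff _ (m - 1) m (m + 1) (by lia) rfl]
      exact fun N y _ ↦ tensorFunctor_map_surjective N _ hd y
  · rw [injective_iff_map_eq_zero]
    intro y hy
    obtain ⟨y, rfl⟩ := tensorFunctor_map_surjective M _ hd y
    rw [← ConcreteCategory.comp_apply, ← Functor.map_comp, ← HomologicalComplex.Hom.comm,
      Functor.map_comp, ConcreteCategory.comp_apply] at hy
    obtain ⟨x, hx⟩ := (tensorExactAt_iff X (m - 1 - 1) (m - 1) m (by lia) (by lia)).1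
      (hX (m - 1) le_rfl) M _ hy
    have := hiso (m - 1 - 1) (by lia)
    have := hiso (m - 1) (by lia)
    obtain ⟨x, rfl⟩ := (AddCommGrpCat.epi_iff_surjective
      ((tensorFunctor M).map ((X.ιTruncLE m).f (m - 1 - 1)))).1 inferInstance x
    rw [← ConcreteCategory.comp_apply, ← Functor.map_comp, HomologicalComplex.Hom.comm,
      Functor.map_comp, ConcreteCategory.comp_apply] at hx
    have h1 : Function.Injective ((tensorFunctor M).map ((X.ιTruncLE m).f (m - 1))) :=
      (AddCommGrpCat.mono_iff_injective _).1 inferInstance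
    rw [← h1 hx, ← ConcreteCategory.comp_apply, ← Functor.map_comp, HomologicalComplex.d_comp_d,
      Functor.map_zero]
    rfl

variable (R)

/-- Truncate `Q` below the bounds of both targets, which do not change under this truncation, and
inside the range where `Q` is pure exact. Functoriality of the truncation gives the factorizations.
-/
lemma leftFactors_pureExact_bounded :
    LeftFactors (pureExact R) (bounded R) (minusPP R ⊓ infPurFinite R) := by
  rintro Q Y Z f g ⟨⟨⟨n, _⟩, -⟩, hQ⟩ ⟨a, a', _, _⟩ ⟨b, b', _, _⟩
  obtain ⟨c, hc⟩ := (infPurFinite_iff Q).1 hQ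
  obtain ⟨f : Q.as ⟶ Y.as, rfl⟩ := (HomotopyCategory.quotient _ _).map_surjective f
  obtain ⟨g : Q.as ⟶ Z.as, rfl⟩ := (HomotopyCategory.quotient _ _).map_surjective g
  obtain ⟨m, ha, hb, hm⟩ : ∃ m : ℤ, m ≤ a ∧ m ≤ b ∧ m < c := ⟨min a (min b (c - 1)), by lia⟩
  have := CochainComplex.isStrictlyGE_of_ge Y.as m a ha
  have := CochainComplex.isStrictlyGE_of_ge Z.as m b hb
  refine ⟨(HomotopyCategory.quotient _ _).obj (CochainComplex.truncGE Q.as m),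
    (HomotopyCategory.quotient _ _).map (CochainComplex.πTruncGE Q.as m),
    (HomotopyCategory.quotient _ _).map
      (CochainComplex.truncGEMap f m ≫ inv (CochainComplex.πTruncGE Y.as m)),
    (HomotopyCategory.quotient _ _).map
      (CochainComplex.truncGEMap g m ≫ inv (CochainComplex.πTruncGE Z.as m)),
    ⟨m, n, ?_, ?_⟩, trW_quotient_map _ (quasiIso_tensor_πTruncGE m fun i hi ↦ hc i (by lia)),
    ?_, ?_⟩
  · exact inferInstanceAs ((CochainComplex.truncGE Q.as m).IsStrictlyGE m)
  · exact inferInstanceAs ((CochainComplex.truncGE Q.as m).IsStrictlyLE n)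
  · exact (Functor.map_comp _ _ _).symm.trans (congrArg _ (by simp))
  · exact (Functor.map_comp _ _ _).symm.trans (congrArg _ (by simp))

lemma rightFactors_pureExact_bounded :
    RightFactors (pureExact R) (bounded R) (plusPI R ⊓ supPurFinite R) := by
  rintro Q Y Z f g ⟨⟨⟨n, _⟩, -⟩, hQ⟩ ⟨a', a, _, _⟩ ⟨b', b, _, _⟩
  obtain ⟨c, hc⟩ := (supPurFinite_iff Q).1 hQ
  obtain ⟨f : Y.as ⟶ Q.as, rfl⟩ := (HomotopyCategory.quotient _ _).map_surjective f
  obtain ⟨g : Z.as ⟶ Q.as, rfl⟩ := (HomotopyCategory.quotient _ _).map_surjective g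
  -- The extra degree is needed because the truncation from above requires exactness from `m - 1`
  -- on.
  obtain ⟨m, ha, hb, hm⟩ : ∃ m : ℤ, a ≤ m ∧ b ≤ m ∧ c < m - 1 := ⟨max a (max b (c + 2)), by lia⟩
  have := CochainComplex.isStrictlyLE_of_le Y.as a m ha
  have := CochainComplex.isStrictlyLE_of_le Z.as b m hb
  refine ⟨(HomotopyCategory.quotient _ _).obj (CochainComplex.truncLE Q.as m),
    (HomotopyCategory.quotient _ _).map (CochainComplex.ιTruncLE Q.as m),
    (HomotopyCategory.quotient _ _).map
      (inv (CochainComplex.ιTruncLE Y.as m) ≫ CochainComplex.truncLEMap f m),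
    (HomotopyCategory.quotient _ _).map
      (inv (CochainComplex.ιTruncLE Z.as m) ≫ CochainComplex.truncLEMap g m),
    ⟨n, m, ?_, ?_⟩, trW_quotient_map _ (quasiIso_tensor_ιTruncLE m fun i hi ↦ hc i (by lia)),
    ?_, ?_⟩
  · exact inferInstanceAs ((CochainComplex.truncLE Q.as m).IsStrictlyGE n)
  · exact inferInstanceAs ((CochainComplex.truncLE Q.as m).IsStrictlyLE m)
  · exact (Functor.map_comp _ _ _).symm.trans (congrArg _ (by simp))
  · exact (Functor.map_comp _ _ _).symm.trans (congrArg _ (by simp))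

end Truncation

/-! ### Stupid truncation and reduction to a single degree -/

section StupidTruncation

variable {C : Type*} [Category* C] [Abelian C]

/-- The distinguished triangle given by the stupid truncations of a complex. -/
lemma exists_stupidTrunc_triangle (X : CochainComplex C ℤ) (n : ℤ) :
    ∃ (A B : CochainComplex C ℤ) (f : A ⟶ X) (g : X ⟶ B)
      (h : (HomotopyCategory.quotient C (.up ℤ)).obj B ⟶
        ((HomotopyCategory.quotient C (.up ℤ)).obj A)⟦(1 : ℤ)⟧),
      Triangle.mk ((HomotopyCategory.quotient C (.up ℤ)).map f)
        ((HomotopyCategory.quotient C (.up ℤ)).map g) h ∈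
          distTriang (HomotopyCategory C (.up ℤ)) ∧
      (∀ i > n, IsIso (f.f i)) ∧ (∀ i ≤ n, IsZero (A.X i)) ∧
      (∀ i ≤ n, IsIso (g.f i)) ∧ (∀ i > n, IsZero (B.X i)) := by
  let e := ComplexShape.embeddingUpIntLE n
  let B := X.stupidTrunc e
  let g : X ⟶ B := e.liftExtend (𝟙 (X.restriction e)) fun j hj ↦ (hj.false_of_isTruncLE).elim
  have hg (i : ℤ) (hi : i ≤ n) : IsIso (g.f i) := by
    have hi' : e.f (n - i).toNat = i := by
      simp [e]; lia
    exact (e.isIso_liftExtend_f_iff (𝟙 (X.restriction e)) _ hi').2 (inferInstanceAs (IsIso (𝟙 _)))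
  have hB (i : ℤ) (hi : n < i) : IsZero (B.X i) :=
    CochainComplex.isZero_of_isStrictlyLE B n i hi
  let S := ShortComplex.mk (kernel.ι g) g (kernel.condition g)
  have hS (i : ℤ) : (S.map (HomologicalComplex.eval C (.up ℤ) i)).Exact :=
    (ShortComplex.exact_kernel g).map _
  have hm (i : ℤ) : Mono (S.map (HomologicalComplex.eval C (.up ℤ) i)).f :=
    inferInstanceAs (Mono ((HomologicalComplex.eval C (.up ℤ) i).map (kernel.ι g)))
  -- In each degree `g` is an isomorphism or has zero target, so the sequence splits degreewise and
  -- defines a distinguished triangle.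
  have hs (i : ℤ) : ∃ s : B.X i ⟶ X.X i, s ≫ g.f i = 𝟙 _ := by
    by_cases hi : i ≤ n
    · have := hg i hi
      exact ⟨inv (g.f i), by simp⟩
    · exact ⟨0, (hB i (by lia)).eq_of_src _ _⟩
  choose s hs using hs
  let σ (i : ℤ) : (S.map (HomologicalComplex.eval C (.up ℤ) i)).Splitting :=
    .ofExactOfSection _ (hS i) (s i) (hs i) (hm i)
  refine ⟨kernel g, B, kernel.ι g, g, (CochainComplex.trianglehOfDegreewiseSplit S σ).mor₃,
    (HomotopyCategory.distinguished_iff_iso_trianglehOfDegreewiseSplit _).2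
      ⟨S, σ, ⟨Iso.refl _⟩⟩, fun i hi ↦ ?_, fun i hi ↦ ?_,
    hg, hB⟩
  · have := hm i
    have : Epi (S.map (HomologicalComplex.eval C (.up ℤ) i)).f :=
      (hS i).epi_f ((hB i hi).eq_of_tgt _ _)
    exact isIso_of_mono_of_epi (S.map (HomologicalComplex.eval C (.up ℤ) i)).f
  · have := hg i hi
    have h0 : (kernel.ι g).f i = 0 := by
      rw [← cancel_mono (g.f i), zero_comp]
      exact (S.map (HomologicalComplex.eval C (.up ℤ) i)).zero
    have := hm i
    exact IsZero.of_mono_eq_zero ((kernel.ι g).f i) h0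

/-- A triangulated subcategory of the homotopy category which contains the complexes concentrated
in one degree contains the bounded complexes. -/
lemma prop_of_isStrictlyGE_of_isStrictlyLE
    (P : ObjectProperty (HomotopyCategory C (.up ℤ))) [P.IsTriangulated]
    [P.IsClosedUnderIsomorphisms]
    (hP : ∀ A : C, P ((HomotopyCategory.quotient C (.up ℤ)).obj
      ((CochainComplex.singleFunctor C 0).obj A)))
    (X : CochainComplex C ℤ) (a b : ℤ) [X.IsStrictlyGE a] [X.IsStrictlyLE b] :
    P ((HomotopyCategory.quotient C (.up ℤ)).obj X) := by
  have h1 (n : ℤ) (X : CochainComplex C ℤ) (_ : X.IsStrictlyGE n) (_ : X.IsStrictlyLE n) :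
      P ((HomotopyCategory.quotient C (.up ℤ)).obj X) := by
    have : (X⟦n⟧).IsStrictlyGE 0 := X.isStrictlyGE_shift n n 0 (by lia)
    have : (X⟦n⟧).IsStrictlyLE 0 := X.isStrictlyLE_shift n n 0 (by lia)
    obtain ⟨A, ⟨i⟩⟩ := (X⟦n⟧).exists_iso_single 0
    rw [← P.prop_shift_iff_of_isStableUnderShift _ n]
    exact P.prop_of_iso ((HomotopyCategory.quotient C (.up ℤ)).mapIso i.symm ≪≫
      ((HomotopyCategory.quotient C (.up ℤ)).commShiftIso n).app X) (hP A)
  -- Induction on the length: the stupid truncation splits off the top term, which is a complex in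
  -- one degree.
  have h2 (k : ℕ) : ∀ (X : CochainComplex C ℤ) (_ : X.IsStrictlyGE a)
      (_ : X.IsStrictlyLE (a + k)), P ((HomotopyCategory.quotient C (.up ℤ)).obj X) := by
    induction k with
    | zero => exact fun X _ h ↦ h1 a X inferInstance (by simpa using h)
    | succ k hk =>
      intro X _ _
      obtain ⟨A, B, f, g, h, hT, hf, hA, hg, hB⟩ := exists_stupidTrunc_triangle X (a + k)
      refine P.ext_of_isTriangulatedClosed₂ _ hT (h1 (a + (k + 1 : ℕ)) A ?_ ?_) (hk B ?_ ?_)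
      · exact (A.isStrictlyGE_iff _).2 fun i hi ↦ hA i (by lia)
      · refine (A.isStrictlyLE_iff _).2 fun i hi ↦ ?_
        have := hf i (by lia)
        exact (X.isZero_of_isStrictlyLE _ i hi).of_iso (asIso (f.f i))
      · refine (B.isStrictlyGE_iff _).2 fun i hi ↦ ?_
        have := hg i (by lia)
        exact (X.isZero_of_isStrictlyGE _ i hi).of_iso (asIso (g.f i)).symm
      · exact (B.isStrictlyLE_iff _).2 hB
  exact h2 (b - a).toNat X inferInstance (X.isStrictlyLE_of_le b _ (by lia))

end StupidTruncation

/-! ### Pure resolutions of modules and of bounded complexes -/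

section Resolutions

variable {R : Type u} [Ring R]

/-- The pure projective module covering a given module. -/
def projCover (A : ModuleCat.{u} R) : ModuleCat.{u} R := (exists_pureProjective A).choose

/-- The map from the pure projective cover. -/
def projCoverMap (A : ModuleCat.{u} R) : projCover A ⟶ A :=
  (exists_pureProjective A).choose_spec.choose

lemma isPureProjective_projCover (A : ModuleCat.{u} R) : IsPureProjective (projCover A) :=
  (exists_pureProjective A).choose_spec.choose_spec.1

lemma projCoverMap_surjective (A : ModuleCat.{u} R) : Function.Surjective (projCoverMap A) :=
  (ModuleCat.epi_iff_surjective _).1 (exists_pureProjective A).choose_spec.choose_spec.2.1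

lemma tensor_kernel_projCoverMap_injective (A : ModuleCat.{u} R) (M : ModuleCat.{u} Rᵐᵒᵖ) :
    Function.Injective ((tensorFunctor M).map (kernel.ι (projCoverMap A))) :=
  (exists_pureProjective A).choose_spec.choose_spec.2.2 M

/-- The iterated kernels of pure projective covers. -/
def syzygy (A : ModuleCat.{u} R) : ℕ → ModuleCat.{u} R
  | 0 => A
  | n + 1 => kernel (projCoverMap (syzygy A n))

/-- The inclusion of a syzygy. -/
def syzygyι (A : ModuleCat.{u} R) (n : ℕ) : syzygy A (n + 1) ⟶ projCover (syzygy A n) :=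
  kernel.ι (projCoverMap (syzygy A n))

lemma syzygyι_comp (A : ModuleCat.{u} R) (n : ℕ) :
    syzygyι A n ≫ projCoverMap (syzygy A n) = 0 :=
  kernel.condition (projCoverMap (syzygy A n))

/-- The terms of the augmented pure projective resolution. -/
def projTerm (A : ModuleCat.{u} R) : ℤ → ModuleCat.{u} R
  | .ofNat 0 => A
  | .ofNat (_ + 1) => 0
  | .negSucc n => projCover (syzygy A n)

/-- The differentials of the augmented pure projective resolution. -/
def projDiff (A : ModuleCat.{u} R) : ∀ n, projTerm A n ⟶ projTerm A (n + 1)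
  | .ofNat _ => 0
  | .negSucc 0 => projCoverMap A
  | .negSucc (n + 1) => projCoverMap (syzygy A (n + 1)) ≫ syzygyι A n

lemma projDiff_comp (A : ModuleCat.{u} R) (n : ℤ) : projDiff A n ≫ projDiff A (n + 1) = 0 := by
  match n with
  | .ofNat _ => exact zero_comp
  | .negSucc 0 => exact comp_zero
  | .negSucc 1 =>
    exact (Category.assoc _ _ _).trans ((congrArg _ (syzygyι_comp A 0)).trans comp_zero)
  | .negSucc (n + 2) =>
    change (projCoverMap (syzygy A (n + 2)) ≫ syzygyι A (n + 1)) ≫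
      projCoverMap (syzygy A (n + 1)) ≫ syzygyι A n = 0
    rw [Category.assoc, reassoc_of% syzygyι_comp A (n + 1), zero_comp, comp_zero]

/-- The augmented pure projective resolution. -/
def projComplex (A : ModuleCat.{u} R) : CochainComplex (ModuleCat.{u} R) ℤ :=
  CochainComplex.of (projTerm A) (projDiff A) (projDiff_comp A)

lemma tensorExactAt_of (X : ℤ → ModuleCat.{u} R) (d : ∀ n, X n ⟶ X (n + 1))
    (h : ∀ n, d n ≫ d (n + 1) = 0) (i : ℤ)
    (H : ∀ (M : ModuleCat.{u} Rᵐᵒᵖ) (y : (tensorFunctor M).obj (X (i + 1))),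
      (tensorFunctor M).map (d (i + 1)) y = 0 → ∃ x, (tensorFunctor M).map (d i) x = y) :
    TensorExactAt (CochainComplex.of X d h) (i + 1) := by
  rw [tensorExactAt_iff _ i (i + 1) (i + 1 + 1) rfl rfl]
  intro M y hy
  have h₁ : (CochainComplex.of X d h).d i (i + 1) = d i := CochainComplex.of_d X d i
  have h₂ : (CochainComplex.of X d h).d (i + 1) (i + 1 + 1) = d (i + 1) :=
    CochainComplex.of_d X d (i + 1)
  rw [h₂] at hy
  rw [h₁]
  exact H M y hy

/-- The module `A` sits in degree `0` and the covers in negative degrees. Each syzygy stays embedded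
after tensoring, so a cycle is killed by the cover map already; right exactness brings it from the
next syzygy, hence from its cover. -/
lemma tensorExactAt_projComplex (A : ModuleCat.{u} R) (n : ℤ) :
    TensorExactAt (projComplex A) n := by
  obtain ⟨i, rfl⟩ : ∃ i, n = i + 1 := ⟨n - 1, by lia⟩
  match i with
  | .ofNat _ => exact tensorExactAt_of_isZero_X (isZero_zero _)
  | .negSucc 0 =>
    exact tensorExactAt_of (projTerm A) (projDiff A) (projDiff_comp A) _ fun M y _ ↦
      tensorFunctor_map_surjective M _ (projCoverMap_surjective A) y
  | .negSucc (n + 1) =>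
    refine tensorExactAt_of (projTerm A) (projDiff A) (projDiff_comp A) _
      fun M (y : (tensorFunctor M).obj (projCover (syzygy A n))) hy ↦ ?_
    have hy' : (tensorFunctor M).map (projCoverMap (syzygy A n)) y = 0 := by
      -- In degree `-1` the outgoing differential is the cover map itself; further down a syzygy
      -- inclusion has to be cancelled.
      cases n with
      | zero => exact hy
      | succ n =>
        refine tensor_kernel_projCoverMap_injective (syzygy A n) M (.trans ?_ (map_zero _).symm)
        exact (ConcreteCategory.congr_hom ((tensorFunctor M).map_comp
          (projCoverMap (syzygy A (n + 1))) (syzygyι A n)) y).symm.trans hy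
    obtain ⟨z, rfl⟩ := tensorFunctor_map_exact M
      (ShortComplex.mk _ _ (kernel.condition (projCoverMap (syzygy A n))))
      (ShortComplex.exact_kernel _) (projCoverMap_surjective _) y hy'
    obtain ⟨x, rfl⟩ := tensorFunctor_map_surjective M _
      (projCoverMap_surjective (syzygy A (n + 1))) z
    refine ⟨x, ?_⟩
    exact ConcreteCategory.congr_hom ((tensorFunctor M).map_comp
      (projCoverMap (syzygy A (n + 1))) (syzygyι A n)) x

/-- A pure injective module containing a given module. -/
def injHull (A : ModuleCat.{u} R) : ModuleCat.{u} R := (exists_pureInjective A).choose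

/-- The map to the pure injective module. -/
def injHullMap (A : ModuleCat.{u} R) : A ⟶ injHull A :=
  (exists_pureInjective A).choose_spec.choose

lemma isPureInjective_injHull (A : ModuleCat.{u} R) : IsPureInjective (injHull A) :=
  (exists_pureInjective A).choose_spec.choose_spec.1

lemma tensor_injHullMap_injective (A : ModuleCat.{u} R) (M : ModuleCat.{u} Rᵐᵒᵖ) :
    Function.Injective ((tensorFunctor M).map (injHullMap A)) :=
  (exists_pureInjective A).choose_spec.choose_spec.2 M

/-- The iterated cokernels of the embeddings in pure injective modules. -/
def cosyzygy (A : ModuleCat.{u} R) : ℕ → ModuleCat.{u} R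
  | 0 => A
  | n + 1 => cokernel (injHullMap (cosyzygy A n))

/-- The projection to a cosyzygy. -/
def cosyzygyπ (A : ModuleCat.{u} R) (n : ℕ) : injHull (cosyzygy A n) ⟶ cosyzygy A (n + 1) :=
  cokernel.π (injHullMap (cosyzygy A n))

lemma cosyzygyπ_surjective (A : ModuleCat.{u} R) (n : ℕ) :
    Function.Surjective (cosyzygyπ A n) :=
  (ModuleCat.epi_iff_surjective (cokernel.π (injHullMap (cosyzygy A n)))).1 inferInstance

lemma comp_cosyzygyπ (A : ModuleCat.{u} R) (n : ℕ) :
    injHullMap (cosyzygy A n) ≫ cosyzygyπ A n = 0 :=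
  cokernel.condition (injHullMap (cosyzygy A n))

/-- The terms of the augmented pure injective resolution. -/
def injTerm (A : ModuleCat.{u} R) : ℤ → ModuleCat.{u} R
  | .ofNat 0 => A
  | .ofNat (n + 1) => injHull (cosyzygy A n)
  | .negSucc _ => 0

/-- The differentials of the augmented pure injective resolution. -/
def injDiff (A : ModuleCat.{u} R) : ∀ n, injTerm A n ⟶ injTerm A (n + 1)
  | .ofNat 0 => injHullMap A
  | .ofNat (n + 1) => cosyzygyπ A n ≫ injHullMap (cosyzygy A (n + 1))
  | .negSucc _ => 0

lemma injDiff_comp (A : ModuleCat.{u} R) (n : ℤ) : injDiff A n ≫ injDiff A (n + 1) = 0 := by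
  match n with
  | .negSucc _ => exact zero_comp
  | .ofNat 0 =>
    exact (Category.assoc _ _ _).symm.trans
      ((congrArg (· ≫ _) (comp_cosyzygyπ A 0)).trans zero_comp)
  | .ofNat (n + 1) =>
    change (cosyzygyπ A n ≫ injHullMap (cosyzygy A (n + 1))) ≫
      cosyzygyπ A (n + 1) ≫ injHullMap (cosyzygy A (n + 2)) = 0
    rw [Category.assoc, reassoc_of% comp_cosyzygyπ A (n + 1), zero_comp, comp_zero]

/-- The augmented pure injective resolution. -/
def injComplex (A : ModuleCat.{u} R) : CochainComplex (ModuleCat.{u} R) ℤ :=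
  CochainComplex.of (injTerm A) (injDiff A) (injDiff_comp A)

lemma tensorExactAt_injComplex (A : ModuleCat.{u} R) (n : ℤ) :
    TensorExactAt (injComplex A) n := by
  obtain ⟨i, rfl⟩ : ∃ i, n = i + 1 := ⟨n - 1, by lia⟩
  match i with
  | .negSucc (n + 1) => exact tensorExactAt_of_isZero_X (isZero_zero _)
  | .negSucc 0 =>
    refine tensorExactAt_of (injTerm A) (injDiff A) (injDiff_comp A) _
      fun M (y : (tensorFunctor M).obj A) hy ↦ ⟨0, ?_⟩
    rw [map_zero]
    exact (tensor_injHullMap_injective A M (hy.trans (map_zero _).symm)).symm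
  | .ofNat n =>
    refine tensorExactAt_of (injTerm A) (injDiff A) (injDiff_comp A) _
      fun M (y : (tensorFunctor M).obj (injHull (cosyzygy A n))) hy ↦ ?_
    have hy' : (tensorFunctor M).map (cosyzygyπ A n) y = 0 := by
      apply tensor_injHullMap_injective (cosyzygy A (n + 1)) M
      rw [map_zero, ← ConcreteCategory.comp_apply]
      exact (ConcreteCategory.congr_hom ((tensorFunctor M).map_comp _ _) y).symm.trans hy
    obtain ⟨z, rfl⟩ := tensorFunctor_map_exact M
      (ShortComplex.mk _ _ (cokernel.condition (injHullMap (cosyzygy A n))))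
      (ShortComplex.exact_cokernel _)
      (cosyzygyπ_surjective A n) y hy'
    cases n with
    | zero => exact ⟨z, rfl⟩
    | succ n =>
      obtain ⟨x, rfl⟩ := tensorFunctor_map_surjective M _
        (cosyzygyπ_surjective A n) z
      refine ⟨x, ?_⟩
      exact ConcreteCategory.congr_hom ((tensorFunctor M).map_comp _ _) x

lemma nonempty_iso_singleFunctor_obj (X : CochainComplex (ModuleCat.{u} R) ℤ) {A : ModuleCat.{u} R}
    (e : X.X 0 ≅ A) (h : ∀ i, i ≠ 0 → IsZero (X.X i)) :
    Nonempty (X ≅ (CochainComplex.singleFunctor (ModuleCat.{u} R) 0).obj A) := by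
  have : X.IsStrictlyGE 0 := (X.isStrictlyGE_iff 0).2 fun i hi ↦ h i (by lia)
  have : X.IsStrictlyLE 0 := (X.isStrictlyLE_iff 0).2 fun i hi ↦ h i (by lia)
  obtain ⟨B, ⟨i⟩⟩ := X.exists_iso_single 0
  exact ⟨i ≪≫ (CochainComplex.singleFunctor (ModuleCat.{u} R) 0).mapIso
    ((HomologicalComplex.singleObjXSelf (.up ℤ) 0 B).symm ≪≫
      HomologicalComplex.Hom.isoApp i.symm 0 ≪≫ e)⟩

variable (R)

/-- The resolvable complexes form a triangulated subcategory, so a module `A` in degree `0`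
suffices. Cutting its augmented resolution between degrees `-1` and `0` gives a triangle whose
connecting map goes from the pure projectives to `A⟦1⟧` and has the shifted augmented resolution,
which is pure exact, as cone. -/
lemma bounded_le_leftResolved_minusPP : bounded R ≤ leftResolved (pureExact R) (minusPP R) := by
  have := leftResolved_isTriangulated (minusPP_le_leftOrthogonal R)
  rintro X ⟨a, b, _, _⟩
  refine prop_of_isStrictlyGE_of_isStrictlyLE (leftResolved (pureExact R) (minusPP R))
    (fun A ↦ ?_) X.as a b
  obtain ⟨K, L, f, g, h, hT, hf, hK, hg, hL⟩ := exists_stupidTrunc_triangle (projComplex A) (-1)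
  have := hf 0 (by lia)
  have e₀ := asIso (f.f 0)
  obtain ⟨e⟩ := nonempty_iso_singleFunctor_obj K (A := A) e₀ fun i hi ↦ by
    by_cases hi' : i ≤ -1
    · exact hK i hi'
    · have := hf i (by lia)
      obtain ⟨n, rfl⟩ : ∃ n : ℕ, i = .ofNat (n + 1) := ⟨(i - 1).toNat, by simp; lia⟩
      have e₁ := asIso (f.f (.ofNat (n + 1)))
      exact (isZero_zero (ModuleCat.{u} R)).of_iso e₁
  refine ObjectProperty.prop_of_iso _ ((HomotopyCategory.quotient _ _).mapIso e) ?_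
  rw [← (leftResolved (pureExact R) (minusPP R)).prop_shift_iff_of_isStableUnderShift _ (1 : ℤ)]
  refine ⟨_, h, ⟨⟨-1, (CochainComplex.isStrictlyLE_iff _ _).2 hL⟩, fun i ↦ ?_⟩,
    .mk _ (rot_of_distTriang _ (rot_of_distTriang _ hT)) ?_⟩
  · by_cases hi : i ≤ -1
    · have := hg i hi
      obtain ⟨n, rfl⟩ : ∃ n : ℕ, i = .negSucc n := ⟨(-i - 1).toNat, by lia⟩
      have e₁ := asIso (g.f (.negSucc n))
      exact (isPureProjective_projCover (syzygy A n)).of_iso e₁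
    · exact isPureProjective_of_isZero (hL i (by lia))
  · exact (pureExact R).le_shift (1 : ℤ) _ ((pureExact_iff _).2 (tensorExactAt_projComplex A))

/-- Here the cut is between degrees `0` and `1`, and the connecting map starts at `A` itself; the
shift falls on the complex of pure injectives. -/
lemma bounded_le_rightResolved_plusPI : bounded R ≤ rightResolved (pureExact R) (plusPI R) := by
  have := rightResolved_isTriangulated (plusPI_le_rightOrthogonal R)
  rintro X ⟨a, b, _, _⟩
  refine prop_of_isStrictlyGE_of_isStrictlyLE (rightResolved (pureExact R) (plusPI R))
    (fun A ↦ ?_) X.as a b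
  obtain ⟨K, L, f, g, h, hT, hf, hK, hg, hL⟩ := exists_stupidTrunc_triangle (injComplex A) 0
  have := hg 0 (by lia)
  have e₀ := asIso (g.f 0)
  obtain ⟨e⟩ := nonempty_iso_singleFunctor_obj L (A := A) e₀.symm fun i hi ↦ by
    by_cases hi' : 0 < i
    · exact hL i hi'
    · have := hg i (by lia)
      obtain ⟨n, rfl⟩ : ∃ n : ℕ, i = .negSucc n := ⟨(-i - 1).toNat, by lia⟩
      have e₁ := asIso (g.f (.negSucc n))
      exact (isZero_zero (ModuleCat.{u} R)).of_iso e₁.symm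
  refine ObjectProperty.prop_of_iso _ ((HomotopyCategory.quotient _ _).mapIso e) ?_
  refine ⟨_, h, (plusPI R).le_shift (1 : ℤ) _
    ⟨⟨1, (CochainComplex.isStrictlyGE_iff _ _).2 fun i hi ↦ hK i (by lia)⟩, fun i ↦ ?_⟩,
    .mk _ (rot_of_distTriang _ (rot_of_distTriang _ hT)) ?_⟩
  · by_cases hi : i ≤ 0
    · exact isPureInjective_of_isZero (hK i hi)
    · have := hf i (by lia)
      obtain ⟨n, rfl⟩ : ∃ n : ℕ, i = .ofNat (n + 1) := ⟨(i - 1).toNat, by simp; lia⟩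
      have e₁ := asIso (f.f (.ofNat (n + 1)))
      exact (isPureInjective_injHull (cosyzygy A n)).of_iso e₁.symm
  · exact (pureExact R).le_shift (1 : ℤ) _ ((pureExact_iff _).2 (tensorExactAt_injComplex A))

/-- The resolution differs from a bounded complex by a pure exact cone, so it inherits finiteness of
`infPur`. -/
lemma bounded_le_leftResolved :
    bounded R ≤ leftResolved (pureExact R) (minusPP R ⊓ infPurFinite R) := by
  intro X hX
  obtain ⟨Q, s, hQ, hs⟩ := bounded_le_leftResolved_minusPP R X hX
  obtain ⟨Z, v, w, hT⟩ := distinguished_cocone_triangle s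
  refine ⟨Q, s, ⟨hQ, (infPurFinite R).ext_of_isTriangulatedClosed₁ _ hT ?_ ?_⟩, hs⟩
  · obtain ⟨a, b, _, _⟩ := hX
    exact (infPurFinite_iff X).2 ⟨a, fun i hi ↦
      tensorExactAt_of_isZero_X (CochainComplex.isZero_of_isStrictlyGE X.as a i hi)⟩
  · exact (infPurFinite_iff Z).2 ⟨0, fun i _ ↦
      (pureExact_iff Z).1 (((pureExact R).trW_iff_of_distinguished _ hT).1 hs) i⟩

lemma bounded_le_rightResolved :
    bounded R ≤ rightResolved (pureExact R) (plusPI R ⊓ supPurFinite R) := by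
  intro X hX
  obtain ⟨Q, s, hQ, hs⟩ := bounded_le_rightResolved_plusPI R X hX
  obtain ⟨Z, v, w, hT⟩ := distinguished_cocone_triangle s
  refine ⟨Q, s, ⟨hQ, (supPurFinite R).ext_of_isTriangulatedClosed₂ _ hT ?_ ?_⟩, hs⟩
  · obtain ⟨a, b, _, _⟩ := hX
    exact (supPurFinite_iff X).2 ⟨b, fun i hi ↦
      tensorExactAt_of_isZero_X (CochainComplex.isZero_of_isStrictlyLE X.as b i hi)⟩
  · exact (supPurFinite_iff Z).2 ⟨0, fun i _ ↦
      (pureExact_iff Z).1 (((pureExact R).trW_iff_of_distinguished _ hT).1 hs) i⟩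

end Resolutions

end

end PureDerived

/-! ### The two equivalences -/

theorem theorem3p6 (R : Type u) [Ring R] :
    PureDerived.TriangleEquivalent (PureDerived.DbPur R) (PureDerived.KMinusPbPP R) ∧
      PureDerived.TriangleEquivalent (PureDerived.DbPur R) (PureDerived.KPlusPbPI R) :=
  ⟨PureDerived.triangleEquivalent_of_leftFactors (PureDerived.DbPur.Q R)
    (inf_le_left.trans (PureDerived.minusPP_le_leftOrthogonal R))
    (PureDerived.bounded_le_leftResolved R) (PureDerived.leftFactors_pureExact_bounded R),
  PureDerived.triangleEquivalent_of_rightFactors (PureDerived.DbPur.Q R)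
    (inf_le_left.trans (PureDerived.plusPI_le_rightOrthogonal R))
    (PureDerived.bounded_le_rightResolved R) (PureDerived.rightFactors_pureExact_bounded R)⟩
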